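/- An \emph{isotopy} of $\mathbb R^3$ is a continuous map $H:[0,1]\times\mathbb R^3\to\mathbb R^3$ with $H(0,\cdot)=\mathrm{id}$ and every $H(t,\cdot)$ a homeomorphism; it is an \emph{ambient isotopy from} an embedding $f$ \emph{to} an embedding $g$ if also $H(1,f(x))=g(x)$ for all $x$. An \emph{arc} is an embedding $[0,1]\to\mathbb R^3$; it is \emph{polygonal} if its image is a finite union of straight segments, and \emph{tame} if there is an ambient isotopy from it to a polygonal arc. For $\varepsilon\in\{1,-1\}$ let $T_\varepsilon$ be the polygonal strand with successive vertices $(-16,0,0)$, $(-15,0,0)$, $(-10,1,-\varepsilon)$, $(-11,-1,4\varepsilon)$, $(-13,-1,-4\varepsilon)$, $(-14,1,\varepsilon)$, $(-9,0,0)$, $(-8,0,0)$, each edge being traversed at constant speed in time $1/7$; it is a right-handed ($\varepsilon=1$) or left-handed ($\varepsilon=-1$) knotted trefoil strand. Given signs $\varepsilon_0,\varepsilon_1,\dots\in\{1,-1\}$, the \emph{countable connected sum of shrinking trefoils} is the map $f:[0,1]\to\mathbb R^3$ with $$f\bigl(1-2^{-k}(1-\tfrac u2)\bigr)=2^{-k}\,T_{\varepsilon_k}(u)\quad(k\ge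 0,\ 0\le u\le 1),\qquad f(1)=0.$$ Let $V_k=[-16\cdot 2^{-k},\,16\cdot 2^{-k}]^3$ for $k\ge0$. \textbf{Proposition 4.5.} For every choice of signs, $f$ is a tame arc. Moreover, the shells $V_k\setminus V_{k+1}$ $(k\ge 0)$ are pairwise disjoint, and there are isotopies $H_0,H_1,\dots$ of $\mathbb R^3$ and an arc $g$ with image the straight segment from $(-16,0,0)$ to the origin such that: (1) for every $k$, $H_k(s,y)=y$ for all $s\in[0,1]$ and all $y\notin V_k\setminus V_{k+1}$, and $H_k(1,\cdot)$ maps the $k$-th trefoil $f([1-2^{-k},1-2^{-k-1}])$ onto the straight segment from $(-16\cdot2^{-k},0,0)$ to $(-16\cdot 2^{-k-1},0,0)$; (2) for all times $0=t_0<t_1<t_2<\cdots$ in $[0,1]$ with $t_k\to1$, performing $H_k$ during $[t_k,t_{k+1}]$ for $k=0,1,2,\dots$ gives an ambient isotopy from $f$ to $g$. That is, with $\mathscr h_k=H_{k-1}(1,\cdot)\circ\cdots\circ H_0(1,\cdot)$ (and $\mathscr h_0=\mathrm{id}$), there is an ambient isotopy $\mathscr H_\infty$ from $f$ to $g$ with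 $\mathscr H_\infty(t_k+s(t_{k+1}-t_k),y)=H_k(s,\mathscr h_k(y))$ for all $k\ge 0$, $s\in[0,1]$, $y\in\mathbb R^3$, and $\mathscr H_\infty(1,y)=\lim_{n\to\infty}\mathscr h_n(y)$ for all $y\in\mathbb R^3$. -/

import Mathlib

open Set Filter Topology

noncomputable section

/-- Euclidean three-space. -/
abbrev E3 : Type := EuclideanSpace ℝ (Fin 3)

/-- `H` is an isotopy of `Y`: continuous on `[0,1] × Y`, the identity at time `0`,
a homeomorphism of `Y` at every time. -/
structure IsIsotopy {Y : Type*} [TopologicalSpace Y] (H : unitInterval → Y → Y) : Prop where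
  continuous : Continuous fun p : unitInterval × Y => H p.1 p.2
  zero : ∀ y, H 0 y = y
  homeomorph : ∀ t, IsHomeomorph (H t)

/-- `H` is an ambient isotopy from the embedding `f₁` to the embedding `f₂`
(pointwise equality at time `1`). -/
structure IsAmbientIsotopy {X Y : Type*} [TopologicalSpace X] [TopologicalSpace Y]
    (H : unitInterval → Y → Y) (f₁ f₂ : X → Y) : Prop where
  source : IsEmbedding f₁
  target : IsEmbedding f₂
  isotopy : IsIsotopy H
  one : ∀ x, H 1 (f₁ x) = f₂ x

/-- A polygonal arc: an embedded arc in `ℝ³` which is a finite union of straight segments. -/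
def IsPolygonalArc (g : unitInterval → E3) : Prop :=
  IsEmbedding g ∧ ∃ S : Finset (E3 × E3), range g = ⋃ s ∈ S, segment ℝ s.1 s.2

/-- A tame arc: an embedded arc in `ℝ³` that is ambient isotopic to a polygonal arc. -/
def IsTameArc (f : unitInterval → E3) : Prop :=
  IsEmbedding f ∧ ∃ g : unitInterval → E3, IsPolygonalArc g ∧
    ∃ H : unitInterval → E3 → E3, IsAmbientIsotopy H f g

/-- The composite `h (n - 1) ∘ ⋯ ∘ h 1 ∘ h 0` of the end maps `h k = H k 1`. -/
def endComp {Y : Type*} (H : ℕ → unitInterval → Y → Y) : ℕ → Y → Y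
  | 0 => id
  | n + 1 => H n 1 ∘ endComp H n

/-- `Hinf` performs the isotopies `H 0, H 1, H 2, …` one after the other, `H k` (sped up) during
the time interval `[t k, t (k + 1)]`, and at time `1` it is the pointwise limit of the finite
composites. When `t 0 = 0` and `t` increases strictly to `1` this determines `Hinf`. -/
def IsIteratedGluing {Y : Type*} [TopologicalSpace Y] (t : ℕ → unitInterval)
    (H : ℕ → unitInterval → Y → Y) (Hinf : unitInterval → Y → Y) : Prop :=
  (∀ (k : ℕ) (s τ : unitInterval), (τ : ℝ) = t k + s * (t (k + 1) - t k) →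
      ∀ y, Hinf τ y = H k s (endComp H k y)) ∧
    ∀ y, Tendsto (fun n => endComp H n y) atTop (𝓝 (Hinf 1 y))

/-- The vertices of a polygonal trefoil strand that runs from `(-16,0,0)` to `(-8,0,0)`.
Write `P i` for the `i`-th vertex and `e i` for the edge from `P i` to `P (i + 1)`. For `ε = 1`,
in the projection to the `xy`-plane seen from `z = +∞` the only crossings are, in the order in
which the strand meets them,
`e 1` over `e 4`, `e 1` under `e 5`, `e 2` over `e 5`, `e 4` under `e 1`, `e 5` over `e 1`,
`e 5` under `e 2`:
the alternating three-crossing diagram with crossing sequence `1, 2, 3, 1, 2, 3`, a (right-handed)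
overhand knot. For `ε = -1` one gets its mirror image in the plane `z = 0`. -/
def trefoilVertex (ε : ℝ) : ℕ → E3
  | 0 => !₂[-16, 0, 0]
  | 1 => !₂[-15, 0, 0]
  | 2 => !₂[-10, 1, -ε]
  | 3 => !₂[-11, -1, 4 * ε]
  | 4 => !₂[-13, -1, -(4 * ε)]
  | 5 => !₂[-14, 1, ε]
  | 6 => !₂[-9, 0, 0]
  | _ => !₂[-8, 0, 0]

/-- The polygonal trefoil strand, parametrized by `u ∈ [0,1]`; each of the seven edges takes
time `1 / 7`. -/
def trefoilStrand (ε : ℝ) (u : ℝ) : E3 :=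
  AffineMap.lineMap (trefoilVertex ε ⌊7 * u⌋₊) (trefoilVertex ε (⌊7 * u⌋₊ + 1)) (Int.fract (7 * u))

/-- The countable connected sum of shrinking trefoils. For `k = 0, 1, 2, …` the parameter interval
`[1 - 2⁻ᵏ, 1 - 2⁻ᵏ⁻¹]` runs through the `k`-th trefoil strand, scaled by `2⁻ᵏ` towards the origin,
so that it starts at `(-16 · 2⁻ᵏ, 0, 0)`, where the previous one ended; the parameter `1` goes to
the origin, at which the trefoils accumulate. The sign `ε k` is the handedness of the `k`-th
trefoil. In the formula, `2ᵏ ≤ 1 / (1 - t) < 2ᵏ⁺¹`. -/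
def trefoilSum (ε : ℕ → ℤˣ) (t : unitInterval) : E3 :=
  if (t : ℝ) = 1 then 0
  else
    let k : ℕ := Nat.log 2 ⌊1 / (1 - (t : ℝ))⌋₊
    (1 / 2 : ℝ) ^ k • trefoilStrand ((ε k : ℤ) : ℝ) (2 - 2 ^ (k + 1) * (1 - (t : ℝ)))

/-- The part of the arc that is the `k`-th trefoil. -/
def trefoilPiece (ε : ℕ → ℤˣ) (k : ℕ) : Set E3 :=
  trefoilSum ε '' {t | 1 - (1 / 2 : ℝ) ^ k ≤ t ∧ (t : ℝ) ≤ 1 - (1 / 2 : ℝ) ^ (k + 1)}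

/-- The point `(x, 0, 0)`. -/
def axisPoint (x : ℝ) : E3 := !₂[x, 0, 0]

/-- The nested boxes `V k`, centred at the origin; the `k`-th trefoil enters `V k` through its left
face and ends on the left face of `V (k + 1)`. -/
def box (k : ℕ) : Set E3 := {p | ∀ i, |p i| ≤ 16 * (1 / 2 : ℝ) ^ k}

/-- The shell `V k \ V (k + 1)`. -/
def shell (k : ℕ) : Set E3 := box k \ box (k + 1)

end

/-!
The arc is straightened one trefoil at a time, by a version of the light bulb trick. The `k`-th strand
runs from the outer to the inner boundary of a thick cubical shell, so it can be unknotted by swinging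
it around the inner cube, and the shell gives this room: everything happens in the `k`-th shell.

*One strand.* By scaling and by reflection in the `xy`-plane it is enough to treat the right-handed
strand between the cubes of radius `16` and `8` about the origin (in the sup norm). A radial
homeomorphism `shrink` replaces the inner cube by a tiny one, and the strand is prolonged straight to
the origin. Conversely, start with the straight segment from `(-16,0,0)` to the origin, and drag the
tiny cube, with the end of the segment attached to it, along the vertices of the trefoil; the cube
lays out the trefoil behind it (`pushes_axisVec`). Each of the six steps is a push
`y ↦ y + φ y • w`, where `φ` is a minimum of affine functionals, truncated to `[0, 1]`; it is a
homeomorphism because `φ` decreases in the direction `w` with slope less than `1`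
(`IsPushFunction.isHomeomorph`). The strand is embedded because the composite of the pushes is
injective (`injOn_strandVec`).

During this motion the tiny cube is only translated, and its centre stays in the convex set `boxRange`.
There is a family of homeomorphisms, depending continuously on `c ∈ boxRange`, which translate the
cube centred at `c` back to the origin. Composing with it at each time turns the motion into an isotopy
that never moves the cube and has the same end map, as the centre returns to the origin at the end
(`IsBoxDrag.push`). Run backwards, it pulls the strand straight (`exists_isotopy_straighten`).

*All strands.* Isotopies in disjoint shells do not interfere, so performing the `k`-th one up to time
`s k` is one map `shellwise H s`. It is continuous away from the origin since only finitely many shells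
meet a small neighbourhood of a point, and at the origin since every `box n` is mapped to itself
(`IsShellFamily.continuous_shellwise`). The gluing in time, the finite composites, their limit and the
straightening of the whole arc are all of this form, for suitable times `s k`.
-/

noncomputable section

/-! ### Homeomorphisms and isotopies -/

/-- A continuous bijection that is the identity off a ball is proper, hence closed. -/
theorem isHomeomorph_of_eq_id_of_le_norm {E : Type*} [NormedAddCommGroup E] [ProperSpace E]
    {f : E → E} (hc : Continuous f) (hb : Function.Bijective f) {R : ℝ}
    (hf : ∀ y, R ≤ ‖y‖ → f y = y) : IsHomeomorph f := by
  rw [isHomeomorph_iff_continuous_isClosedMap_bijective]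
  refine ⟨hc, IsProperMap.isClosedMap ?_, hb⟩
  rw [isProperMap_iff_tendsto_cocompact]
  refine ⟨hc, tendsto_id.congr' ?_⟩
  filter_upwards [(tendsto_norm_cocompact_atTop (E := E)).eventually_ge_atTop R] with y hy
  exact (hf y hy).symm

namespace IsIsotopy

variable {Y Z : Type*} [TopologicalSpace Y] [TopologicalSpace Z]

theorem continuous_apply {H : unitInterval → Y → Y} (hH : IsIsotopy H) {X : Type*}
    [TopologicalSpace X] {a : X → unitInterval} {b : X → Y} (ha : Continuous a)
    (hb : Continuous b) : Continuous fun x => H (a x) (b x) :=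
  hH.continuous.comp (ha.prodMk hb)

theorem comp {H K : unitInterval → Y → Y} (hH : IsIsotopy H) (hK : IsIsotopy K) :
    IsIsotopy fun t y => H t (K t y) where
  continuous := hH.continuous_apply continuous_fst hK.continuous
  zero y := by rw [hK.zero, hH.zero]
  homeomorph t := (hH.homeomorph t).comp (hK.homeomorph t)

theorem conj {H : unitInterval → Y → Y} (hH : IsIsotopy H) (e : Y ≃ₜ Z) :
    IsIsotopy fun t z => e (H t (e.symm z)) where
  continuous := e.continuous.comp
    (hH.continuous_apply continuous_fst (e.symm.continuous.comp continuous_snd))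
  zero z := by rw [hH.zero, e.apply_symm_apply]
  homeomorph t := e.isHomeomorph.comp ((hH.homeomorph t).comp e.symm.isHomeomorph)

/-- Running an isotopy backwards, starting from the identity, undoes its end map. -/
theorem reverse {H : unitInterval → Y → Y} (hH : IsIsotopy H) {e : Y ≃ₜ Y} (he : ∀ y, H 1 y = e y) :
    IsIsotopy fun t y => H (unitInterval.symm t) (e.symm y) where
  continuous := hH.continuous_apply (unitInterval.continuous_symm.comp continuous_fst)
    (e.symm.continuous.comp continuous_snd)
  zero y := by rw [unitInterval.symm_zero, he, e.apply_symm_apply]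
  homeomorph t := (hH.homeomorph _).comp e.symm.isHomeomorph

end IsIsotopy

/-! ### Truncated minima -/

section Cutoff

variable {X : Type*}

/-- The minimum of the functions in the list `l`, truncated to take values in `[0, 1]`. -/
def cutoff (l : List (X → ℝ)) (y : X) : ℝ :=
  max 0 (l.foldr (fun A m => min (A y) m) 1)

theorem foldr_min_le (l : List (X → ℝ)) (y : X) : l.foldr (fun A m => min (A y) m) 1 ≤ 1 := by
  induction l with
  | nil => simp
  | cons B l ih => exact (min_le_right _ _).trans ih

theorem foldr_min_eq_one {l : List (X → ℝ)} {y : X} (h : ∀ A ∈ l, 1 ≤ A y) :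
    l.foldr (fun A m => min (A y) m) 1 = 1 := by
  induction l with
  | nil => simp
  | cons B l ih =>
    rw [List.forall_mem_cons] at h
    rw [List.foldr_cons, ih h.2, min_eq_right h.1]

theorem cutoff_eq_one {l : List (X → ℝ)} {y : X} (h : ∀ A ∈ l, 1 ≤ A y) : cutoff l y = 1 := by
  rw [cutoff, foldr_min_eq_one h, max_eq_right zero_le_one]

theorem cutoff_cons_eq {A : X → ℝ} {l : List (X → ℝ)} {y : X} (h0 : 0 ≤ A y) (h1 : A y ≤ 1)
    (h : ∀ B ∈ l, 1 ≤ B y) : cutoff (A :: l) y = A y := by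
  rw [cutoff, List.foldr_cons, foldr_min_eq_one h, min_eq_left h1, max_eq_right h0]

theorem cutoff_eq_zero {l : List (X → ℝ)} {y : X} {A : X → ℝ} (hA : A ∈ l) (h : A y ≤ 0) :
    cutoff l y = 0 := by
  refine max_eq_left ?_
  induction l with
  | nil => simp at hA
  | cons B l ih =>
    rcases List.mem_cons.1 hA with rfl | hA
    · exact (min_le_left _ _).trans h
    · exact (min_le_right _ _).trans (ih hA)

end Cutoff

/-! ### Pushes along a vector -/

section Push

variable {E : Type*} [NormedAddCommGroup E] [NormedSpace ℝ E]

/-- Along the direction `w` the function `φ` decreases with slope less than `1` in absolute value;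
equivalently, `s ↦ s + φ (y + s • w)` is strictly increasing for all `y`. -/
def DescendsSlowly (w : E) (φ : E → ℝ) : Prop :=
  ∀ y, ∀ s > 0, φ y < φ (y + s • w) + s

namespace DescendsSlowly

variable {w : E} {φ ψ : E → ℝ}

theorem const (c : ℝ) : DescendsSlowly w fun _ => c := fun _ s hs => by linarith

theorem min (hφ : DescendsSlowly w φ) (hψ : DescendsSlowly w ψ) :
    DescendsSlowly w fun y => min (φ y) (ψ y) := fun y s hs => by
  rw [← min_add_add_right]
  exact min_lt_min (hφ y s hs) (hψ y s hs)

theorem max (hφ : DescendsSlowly w φ) (hψ : DescendsSlowly w ψ) :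
    DescendsSlowly w fun y => max (φ y) (ψ y) := fun y s hs => by
  rw [← max_add_add_right]
  exact max_lt_max (hφ y s hs) (hψ y s hs)

theorem const_mul {t : ℝ} (ht0 : 0 ≤ t) (ht1 : t ≤ 1) (hφ : DescendsSlowly w φ) :
    DescendsSlowly w fun y => t * φ y := fun y s hs => by
  have h := hφ y s hs
  rcases ht0.eq_or_lt with rfl | ht
  · simpa using hs
  · have := mul_lt_mul_of_pos_left h ht
    have := mul_le_mul_of_nonneg_right ht1 hs.le
    show t * φ y < t * φ (y + s • w) + s
    linarith

end DescendsSlowly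

/-- Hypotheses on a function `φ` with values in `[0, 1]` under which `y ↦ y + φ y • w` is a homeomorphism supported in the ball of
radius `R` about the origin. -/
structure IsPushFunction (R : ℝ) (w : E) (φ : E → ℝ) : Prop where
  continuous : Continuous φ
  nonneg : ∀ y, 0 ≤ φ y
  le_one : ∀ y, φ y ≤ 1
  descends : DescendsSlowly w φ
  support : ∀ y, R ≤ ‖y‖ → φ y = 0

namespace IsPushFunction

variable {R : ℝ} {w : E} {φ : E → ℝ}

theorem const_mul {t : ℝ} (ht0 : 0 ≤ t) (ht1 : t ≤ 1) (h : IsPushFunction R w φ) :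
    IsPushFunction R w fun y => t * φ y where
  continuous := continuous_const.mul h.continuous
  nonneg y := mul_nonneg ht0 (h.nonneg y)
  le_one y := mul_le_one₀ ht1 (h.nonneg y) (h.le_one y)
  descends := h.descends.const_mul ht0 ht1
  support y hy := by rw [h.support y hy, mul_zero]

theorem isHomeomorph [ProperSpace E] (h : IsPushFunction R w φ) :
    IsHomeomorph fun y => y + φ y • w := by
  have hc := h.continuous
  refine isHomeomorph_of_eq_id_of_le_norm (by fun_prop) ⟨fun y z hyz => ?_, fun z => ?_⟩ (R := R)
    fun y hy => by simp [h.support y hy]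
  · -- both points lie on one line in direction `w`, along which the push is strictly increasing
    have hyz : y + φ y • w = z + φ z • w := hyz
    have key : ∀ y z : E, y + φ y • w = z + φ z • w → ¬ φ z < φ y := by
      intro y z hyz hlt
      have hz : y + (φ y - φ z) • w = z := by
        rw [sub_smul, ← add_sub_assoc, hyz, add_sub_cancel_right]
      have := h.descends y (φ y - φ z) (sub_pos.2 hlt)
      rw [hz] at this
      linarith
    have : φ y = φ z := le_antisymm (not_lt.1 (key y z hyz)) (not_lt.1 (key z y hyz.symm))
    rw [this] at hyz
    exact add_right_cancel hyz
  · have hcont : Continuous fun s : ℝ => φ (z - s • w) - s := by fun_prop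
    obtain ⟨s, -, hs⟩ := intermediate_value_Icc' zero_le_one hcont.continuousOn
      (show (0 : ℝ) ∈ Icc (φ (z - (1 : ℝ) • w) - 1) (φ (z - (0 : ℝ) • w) - 0) from
        ⟨by linarith [h.le_one (z - (1 : ℝ) • w)], by linarith [h.nonneg (z - (0 : ℝ) • w)]⟩)
    have hs' : φ (z - s • w) = s := by simpa [sub_eq_zero] using hs
    exact ⟨z - s • w, by simp [hs']⟩

theorem isIsotopy [ProperSpace E] (h : IsPushFunction R w φ) :
    IsIsotopy fun (t : unitInterval) y => y + ((t : ℝ) * φ y) • w where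
  continuous := by
    have := h.continuous
    fun_prop
  zero y := by simp
  homeomorph t := (h.const_mul t.2.1 t.2.2).isHomeomorph

end IsPushFunction

theorem isPushFunction_cutoff {l : List (E → ℝ)} {R : ℝ} {w : E} (hc : ∀ A ∈ l, Continuous A)
    (hd : ∀ A ∈ l, DescendsSlowly w A) (hs : ∀ y, R ≤ ‖y‖ → ∃ A ∈ l, A y ≤ 0) :
    IsPushFunction R w (cutoff l) where
  continuous := by
    refine continuous_const.max ?_
    clear hd hs
    induction l with
    | nil => exact continuous_const
    | cons B l ih =>
      rw [List.forall_mem_cons] at hc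
      exact hc.1.min (ih hc.2)
  nonneg y := le_max_left _ _
  le_one y := max_le zero_le_one (foldr_min_le l y)
  descends := by
    refine (DescendsSlowly.const 0).max ?_
    clear hc hs
    induction l with
    | nil => exact DescendsSlowly.const 1
    | cons B l ih =>
      rw [List.forall_mem_cons] at hd
      exact hd.1.min (ih hd.2)
  support y hy := by
    obtain ⟨A, hA, h⟩ := hs y hy
    exact cutoff_eq_zero hA h

end Push

/-! ### Dragging a small box along the trefoil -/

/-- The point `(x, 0, 0)`, in coordinates. -/
def axisVec (x : ℝ) : Fin 3 → ℝ := ![x, 0, 0]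

/-- The coordinates of the vertices of the right-handed trefoil strand. The last edge is
prolonged to a point close to the origin. -/
def knotVertex : ℕ → Fin 3 → ℝ
  | 0 => ![-16, 0, 0]
  | 1 => ![-15, 0, 0]
  | 2 => ![-10, 1, -1]
  | 3 => ![-11, -1, 4]
  | 4 => ![-13, -1, -4]
  | 5 => ![-14, 1, 1]
  | 6 => ![-9, 0, 0]
  | _ => ![-1 / 100, 0, 0]

/-- Before the `i`-th push, the part of the segment from `(-16,0,0)` to the origin that has not
yet been laid out as a part of the trefoil has length `whisker i`; it is the horizontal segment
from `knotVertex i` to `boxCentre i`. -/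
def whisker : ℕ → ℝ
  | 0 => 16
  | 1 => 15
  | 2 => 6 / 100
  | 3 => 5 / 100
  | 4 => 4 / 100
  | 5 => 3 / 100
  | 6 => 2 / 100
  | _ => 1 / 100

/-- The position of the small box before the `i`-th push. -/
def boxCentre (i : ℕ) : Fin 3 → ℝ := knotVertex i + axisVec (whisker i)

/-- The five functionals that keep a push inside the cube of radius `16`, except on its left. -/
def cubeWalls : List ((Fin 3 → ℝ) → ℝ) :=
  [fun y => (16 - y 0) / 10, fun y => (16 - y 1) / 10, fun y => (16 + y 1) / 10,
    fun y => (16 - y 2) / 10, fun y => (16 + y 2) / 10]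

/-- The affine functional that grows from `0` to `1` along the part of the whisker that the `i`-th
push stretches to the `i`-th edge. It is nonpositive on the edge that ends at `knotVertex i`. -/
def pushRamp : ℕ → (Fin 3 → ℝ) → ℝ
  | 1 => fun y => 100 / 1494 * (y 0 + 15)
  | 2 => fun y => 100 * (y 0 + 10 + (y 2 + 1) / 2)
  | 3 => fun y => 100 * (y 0 + 11 - 2 * (y 1 + 1) - 3 / 10 * (y 2 - 4))
  | 4 => fun y => 100 * (y 0 + 13 + 5 / 4 * (y 1 + 1) - (y 2 + 4) / 4)
  | 5 => fun y => 100 * (y 0 + 14 + 2 * (y 1 - 1))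
  | _ => fun y => 100 * (y 0 + 9)

/-- The affine functionals that keep the `i`-th push away from the left face of the cube and, where
the `i`-th edge crosses earlier ones, from these. In the latter case the functional is constant both
on the earlier edge and along the `i`-th edge. -/
def pushWalls : ℕ → List ((Fin 3 → ℝ) → ℝ)
  | 2 => (fun y => (16 + y 0) / 2) :: cubeWalls
  | 3 => (fun y => (16 + y 0) / 4) :: cubeWalls
  | 4 => (fun y => (-7 * y 0 + 24 * y 1 - 11 * y 2 - 105) / 5) ::
      (fun y => (16 + y 0) / 2) :: cubeWalls
  | 5 => (fun y => (-7 * y 0 - 24 * y 1 - 11 * y 2 - 57) / 5) ::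
      (fun y => (2 * y 0 + 10 * y 2 + 30) / 10) :: (fun y => 16 + y 0) :: cubeWalls
  | _ => cubeWalls

/-- It takes the value `1` near `boxCentre i`, grows along the whisker, and vanishes on the edges that
have been laid out before. -/
def pushFunction (i : ℕ) : (Fin 3 → ℝ) → ℝ := cutoff (pushRamp i :: pushWalls i)

/-- The `i`-th push carries the small box from `boxCentre i` to `boxCentre (i + 1)` and lays out the
edge from `knotVertex i` to `knotVertex (i + 1)` behind it. -/
def push (i : ℕ) (y : Fin 3 → ℝ) : Fin 3 → ℝ :=
  y + pushFunction i y • (boxCentre (i + 1) - boxCentre i)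

theorem exists_coord_of_le_norm {R : ℝ} (hR : 0 < R) {y : Fin 3 → ℝ} (hy : R ≤ ‖y‖) :
    (R ≤ y 0 ∨ y 0 ≤ -R) ∨ (R ≤ y 1 ∨ y 1 ≤ -R) ∨ R ≤ y 2 ∨ y 2 ≤ -R := by
  contrapose! hy
  rw [pi_norm_lt_iff hR, Fin.forall_fin_succ, Fin.forall_fin_succ, Fin.forall_fin_succ]
  simp only [Real.norm_eq_abs, abs_lt]
  obtain ⟨⟨h1, h2⟩, ⟨h3, h4⟩, h5, h6⟩ := hy
  exact ⟨⟨h2, h1⟩, ⟨h4, h3⟩, ⟨h6, h5⟩, fun i => i.elim0⟩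

theorem abs_coord_le {r : ℝ} {y : Fin 3 → ℝ} (hy : ‖y‖ ≤ r) :
    (-r ≤ y 0 ∧ y 0 ≤ r) ∧ (-r ≤ y 1 ∧ y 1 ≤ r) ∧ -r ≤ y 2 ∧ y 2 ≤ r := by
  have h := fun i => abs_le.1 ((norm_le_pi_norm y i).trans hy)
  exact ⟨h 0, h 1, h 2⟩

theorem exists_cubeWalls_nonpos {y : Fin 3 → ℝ} (hy : 16 ≤ ‖y‖) :
    y 0 ≤ -16 ∨ ∃ A ∈ cubeWalls, A y ≤ 0 := by
  simp only [cubeWalls, List.exists_mem_cons_iff]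
  rcases exists_coord_of_le_norm (by norm_num) hy with (h | h) | (h | h) | h | h
  · exact Or.inr <| .inl (by linarith)
  · exact Or.inl h
  · exact Or.inr <| .inr <| .inl (by linarith)
  · exact Or.inr <| .inr <| .inr <| .inl (by linarith)
  · exact Or.inr <| .inr <| .inr <| .inr <| .inl (by linarith)
  · exact Or.inr <| .inr <| .inr <| .inr <| .inr <| .inl (by linarith)

theorem isPushFunction_pushFunction {i : ℕ} (h1 : 1 ≤ i) (h6 : i ≤ 6) :
    IsPushFunction 16 (boxCentre (i + 1) - boxCentre i) (pushFunction i) := by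
  refine isPushFunction_cutoff ?_ ?_ fun y hy => ?_
  · interval_cases i <;>
      simp only [pushRamp, pushWalls, cubeWalls, List.forall_mem_cons] <;>
      (repeat' apply And.intro) <;> first | fun_prop | simp
  · interval_cases i <;>
      simp only [pushRamp, pushWalls, cubeWalls, List.forall_mem_cons, DescendsSlowly] <;>
      (repeat' apply And.intro) <;> first | (simp; done) | skip
    all_goals
      intro y s hs
      simp only [Pi.add_apply, Pi.smul_apply, smul_eq_mul, boxCentre, Pi.sub_apply, knotVertex,
        whisker, axisVec, Matrix.cons_val]
      linarith
  · rcases exists_cubeWalls_nonpos hy with h | ⟨A, hA, h⟩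
    · interval_cases i <;> simp only [pushRamp, pushWalls, List.exists_mem_cons_iff]
      · exact .inl (by norm_num; linarith)
      · exact .inr <| .inl (by linarith)
      · exact .inr <| .inl (by linarith)
      · exact .inr <| .inr <| .inl (by linarith)
      · exact .inr <| .inr <| .inr <| .inl (by linarith)
      · exact .inl (by linarith)
    · refine ⟨A, List.mem_cons_of_mem _ ?_, h⟩
      interval_cases i <;> simp [pushWalls, hA]

/-- The edge of the strand from `knotVertex i` to `knotVertex (i + 1)`, parametrized by `[0, 1]`. -/
def knotEdge (i : ℕ) (τ : ℝ) : Fin 3 → ℝ :=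
  knotVertex i + τ • (knotVertex (i + 1) - knotVertex i)

/-- A push fixes the edges that have been laid out before. -/
theorem pushFunction_knotEdge {i j : ℕ} (hj : j < i) (h6 : i ≤ 6) {τ : ℝ} (h0 : 0 ≤ τ)
    (h1 : τ ≤ 1) : pushFunction i (knotEdge j τ) = 0 := by
  have key : ∃ A ∈ pushRamp i :: pushWalls i, A (knotEdge j τ) ≤ 0 := by
    interval_cases i <;> interval_cases j <;>
      simp only [pushRamp, pushWalls, cubeWalls, List.exists_mem_cons_iff, knotEdge, knotVertex,
        Pi.add_apply, Pi.smul_apply, smul_eq_mul, Pi.sub_apply, Matrix.cons_val] <;>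
      first
      | exact .inl (by linarith)
      | exact .inr (.inl (by linarith))
      | exact .inr (.inr (.inl (by linarith)))
  obtain ⟨A, hA, h⟩ := key
  exact cutoff_eq_zero hA h

/-- On the part of the whisker that is stretched, the push function is linear. -/
theorem pushFunction_whisker {i : ℕ} (h1 : 1 ≤ i) (h6 : i ≤ 6) {τ : ℝ} (h0 : 0 ≤ τ)
    (hτ : τ ≤ 1) :
    pushFunction i (knotVertex i + axisVec (τ * (whisker i - whisker (i + 1)))) = τ := by
  have key : pushRamp i (knotVertex i + axisVec (τ * (whisker i - whisker (i + 1)))) = τ := by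
    interval_cases i <;>
      simp only [pushRamp, knotVertex, axisVec, whisker, Pi.add_apply, Matrix.cons_val] <;> ring
  rw [pushFunction, cutoff_cons_eq (by rwa [key]) (by rwa [key]), key]
  interval_cases i <;>
    simp only [pushWalls, cubeWalls, List.forall_mem_cons] <;>
    (repeat' apply And.intro) <;> first | (simp; done) | skip
  all_goals
    simp only [knotVertex, axisVec, whisker, Pi.add_apply, Matrix.cons_val]
    linarith

theorem pushFunction_whisker_end {i : ℕ} (h1 : 1 ≤ i) (h6 : i ≤ 6) {a : ℝ}
    (h0 : whisker i - whisker (i + 1) ≤ a) (ha : a ≤ whisker i) :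
    pushFunction i (knotVertex i + axisVec a) = 1 := by
  refine cutoff_eq_one ?_
  interval_cases i <;>
    simp only [pushRamp, pushWalls, cubeWalls, List.forall_mem_cons] <;>
    (repeat' apply And.intro) <;> first | (simp; done) | skip
  all_goals
    simp only [knotVertex, axisVec, whisker, Pi.add_apply, Matrix.cons_val] at h0 ha ⊢
    linarith

theorem pushFunction_boxCentre_add {i : ℕ} (h1 : 1 ≤ i) (h6 : i ≤ 6) {y : Fin 3 → ℝ}
    (hy : ‖y‖ ≤ 1 / 1000) : pushFunction i (boxCentre i + y) = 1 := by
  obtain ⟨⟨hx, hx'⟩, ⟨hy, hy'⟩, hz, hz'⟩ := abs_coord_le hy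
  refine cutoff_eq_one ?_
  interval_cases i <;>
    simp only [pushRamp, pushWalls, cubeWalls, List.forall_mem_cons] <;>
    (repeat' apply And.intro) <;> first | (simp; done) | skip
  all_goals
    simp only [boxCentre, knotVertex, axisVec, whisker, Pi.add_apply, Matrix.cons_val]
    linarith

/-- The composite of the first `n` pushes. -/
def pushes : ℕ → (Fin 3 → ℝ) → Fin 3 → ℝ
  | 0 => id
  | n + 1 => push (n + 1) ∘ pushes n

theorem axisVec_eq_smul (x : ℝ) : axisVec x = x • axisVec 1 := by
  ext i; fin_cases i <;> simp [axisVec]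

/-- After `n` pushes the first `n + 1` edges have been laid out, and the rest of the segment is the
whisker. -/
theorem pushes_axisVec {n : ℕ} (hn : n ≤ 6) :
    (∀ j ≤ n, ∀ τ ∈ Icc (0 : ℝ) 1,
      pushes n (axisVec (-whisker j + τ * (whisker j - whisker (j + 1)))) = knotEdge j τ) ∧
    ∀ a ∈ Icc 0 (whisker (n + 1)),
      pushes n (axisVec (-whisker (n + 1) + a)) = knotVertex (n + 1) + axisVec a := by
  induction n with
  | zero =>
    refine ⟨fun j hj τ _ => ?_, fun a _ => ?_⟩
    · obtain rfl : j = 0 := by omega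
      ext i
      fin_cases i <;> norm_num [pushes, knotEdge, knotVertex, axisVec, whisker]
    · ext i
      fin_cases i <;> simp [pushes, knotVertex, axisVec, whisker]
  | succ n ih =>
    obtain ⟨ih1, ih2⟩ := ih (by omega)
    have hw : 0 ≤ whisker (n + 1) - whisker (n + 2) ∧ 0 ≤ whisker (n + 2) := by
      have : n ≤ 5 := by omega
      interval_cases n <;> norm_num [whisker]
    refine ⟨fun j hj τ hτ => ?_, fun a ha => ?_⟩
    · rcases Nat.lt_or_ge j (n + 1) with hj' | hj'
      · rw [pushes, Function.comp_apply, ih1 j (by omega) τ hτ, push,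
          pushFunction_knotEdge hj' hn hτ.1 hτ.2, zero_smul, add_zero]
      · obtain rfl : j = n + 1 := by omega
        rw [pushes, Function.comp_apply, ih2 _ ⟨mul_nonneg hτ.1 hw.1, by nlinarith [hτ.2]⟩, push,
          pushFunction_whisker (by omega) hn hτ.1 hτ.2, knotEdge, boxCentre, boxCentre]
        simp only [axisVec_eq_smul (whisker _), axisVec_eq_smul (_ * _)]
        module
    · have h : -whisker (n + 2) + a =
          -whisker (n + 1) + (a + (whisker (n + 1) - whisker (n + 2))) := by ring
      rw [pushes, Function.comp_apply, h, ih2 _ ⟨by linarith [ha.1], by linarith [ha.2]⟩, push,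
        pushFunction_whisker_end (by omega) hn (by linarith [ha.1]) (by linarith [ha.2]),
        boxCentre, boxCentre]
      simp only [axisVec_eq_smul (whisker _), axisVec_eq_smul a, axisVec_eq_smul (_ + _)]
      module

/-! ### Bringing the small box back -/

/-- A convex set that contains the positions which the centre of the small box takes while it is
dragged. -/
def boxRange : Set (Fin 3 → ℝ) :=
  {c | (-14 ≤ c 0 ∧ c 0 ≤ 0) ∧ (-1 ≤ c 1 ∧ c 1 ≤ 1) ∧ -4 ≤ c 2 ∧ c 2 ≤ 4}

theorem convex_boxRange : Convex ℝ boxRange := by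
  rintro x ⟨⟨h1, h2⟩, ⟨h3, h4⟩, h5, h6⟩ y ⟨⟨k1, k2⟩, ⟨k3, k4⟩, k5, k6⟩ a b ha hb hab
  obtain rfl : a = 1 - b := by linarith
  simp only [boxRange, mem_ofPred_eq, Pi.add_apply, Pi.smul_apply, smul_eq_mul]
  refine ⟨⟨?_, ?_⟩, ⟨?_, ?_⟩, ?_, ?_⟩ <;> nlinarith

theorem boxCentre_mem_boxRange {i : ℕ} (h1 : 1 ≤ i) (h7 : i ≤ 7) : boxCentre i ∈ boxRange := by
  interval_cases i <;>
    simp only [boxRange, boxCentre, knotVertex, whisker, axisVec, mem_ofPred_eq, Pi.add_apply,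
      Matrix.cons_val] <;> norm_num

/-- The affine functionals that keep the return of the box inside the cube of radius `16`. The slope of
the first one has to be less than `1 / 14` for the return from points as far left as `-14`, and its
value has to be at least `1` up to a little to the right of the origin. -/
def returnWalls : List ((Fin 3 → ℝ) → ℝ) :=
  [fun y => (16 - y 0) / 15, fun y => 16 + y 0, fun y => (16 - y 1) / 10, fun y => (16 + y 1) / 10,
    fun y => (16 - y 2) / 10, fun y => (16 + y 2) / 10]

theorem isPushFunction_returnWalls {c : Fin 3 → ℝ} (hc : c ∈ boxRange) :
    IsPushFunction 16 (-c) (cutoff returnWalls) := by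
  obtain ⟨⟨h1, h2⟩, ⟨h3, h4⟩, h5, h6⟩ := hc
  refine isPushFunction_cutoff ?_ ?_ fun y hy => ?_
  · simp only [returnWalls, List.forall_mem_cons]
    (repeat' apply And.intro) <;> first | fun_prop | simp
  · simp only [returnWalls, List.forall_mem_cons, DescendsSlowly]
    (repeat' apply And.intro) <;> first | (simp; done) | skip
    all_goals
      intro y s hs
      simp only [Pi.add_apply, Pi.smul_apply, smul_eq_mul, Pi.neg_apply]
      nlinarith
  · simp only [returnWalls, List.exists_mem_cons_iff]
    rcases exists_coord_of_le_norm (by norm_num) hy with (h | h) | (h | h) | h | h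
    · exact .inl (by linarith)
    · exact .inr <| .inl (by linarith)
    · exact .inr <| .inr <| .inl (by linarith)
    · exact .inr <| .inr <| .inr <| .inl (by linarith)
    · exact .inr <| .inr <| .inr <| .inr <| .inl (by linarith)
    · exact .inr <| .inr <| .inr <| .inr <| .inr <| .inl (by linarith)

theorem cutoff_returnWalls_add {c y : Fin 3 → ℝ} (hc : c ∈ boxRange) (hy : ‖y‖ ≤ 1 / 1000) :
    cutoff returnWalls (c + y) = 1 := by
  obtain ⟨⟨h1, h2⟩, ⟨h3, h4⟩, h5, h6⟩ := hc
  obtain ⟨⟨hx, hx'⟩, ⟨hy, hy'⟩, hz, hz'⟩ := abs_coord_le hy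
  refine cutoff_eq_one ?_
  simp only [returnWalls, List.forall_mem_cons, Pi.add_apply]
  (repeat' apply And.intro) <;> first | linarith | simp

/-- A homeomorphism which carries a neighbourhood of `c` by translation to a neighbourhood of the
origin and fixes everything outside the cube of radius `16`. It depends continuously on `c`. -/
def boxReturn (c y : Fin 3 → ℝ) : Fin 3 → ℝ := y + cutoff returnWalls y • -c

theorem boxReturn_add {c y : Fin 3 → ℝ} (hc : c ∈ boxRange) (hy : ‖y‖ ≤ 1 / 1000) :
    boxReturn c (c + y) = y := by
  rw [boxReturn, cutoff_returnWalls_add hc hy, one_smul]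
  abel

theorem boxReturn_of_le_norm {c y : Fin 3 → ℝ} (hc : c ∈ boxRange) (hy : 16 ≤ ‖y‖) :
    boxReturn c y = y := by
  rw [boxReturn, (isPushFunction_returnWalls hc).support y hy, zero_smul, add_zero]

/-- `Ψ`, followed by bringing the box back from `c` to the origin, is the end of an isotopy of the
cube of radius `16` which never moves the box. -/
def IsBoxDrag (c : Fin 3 → ℝ) (Ψ : (Fin 3 → ℝ) → Fin 3 → ℝ) : Prop :=
  ∃ K : unitInterval → (Fin 3 → ℝ) → Fin 3 → ℝ, IsIsotopy K ∧
    (∀ t y, ‖y‖ ≤ 1 / 1000 → K t y = y) ∧ (∀ t y, 16 ≤ ‖y‖ → K t y = y) ∧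
    ∀ y, K 1 y = boxReturn c (Ψ y)

/-- A box drag may be followed by a push that carries the box along. At time `t` the push has moved
the box to `c + t • w`, from where it is brought back at once. -/
theorem IsBoxDrag.push {c w : Fin 3 → ℝ} {Ψ : (Fin 3 → ℝ) → Fin 3 → ℝ} {φ : (Fin 3 → ℝ) → ℝ}
    (h : IsBoxDrag c Ψ) (hc : c ∈ boxRange) (hcw : c + w ∈ boxRange) (hφ : IsPushFunction 16 w φ)
    (hφc : ∀ y, ‖y‖ ≤ 1 / 1000 → φ (c + y) = 1) :
    IsBoxDrag (c + w) fun y => Ψ y + φ (Ψ y) • w := by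
  obtain ⟨K, hK, hin, hout, hone⟩ := h
  have hmem : ∀ t : unitInterval, c + (t : ℝ) • w ∈ boxRange := fun t => by
    have := convex_boxRange hc hcw (a := 1 - t) (b := t) (by linarith [t.2.2]) t.2.1 (by ring)
    convert this using 1
    module
  let e : (Fin 3 → ℝ) ≃ₜ (Fin 3 → ℝ) := (isPushFunction_returnWalls hc).isHomeomorph.homeomorph
  have he : ∀ y, e y = boxReturn c y := fun y => rfl
  have hes : ∀ y, e.symm (boxReturn c y) = y := fun y => by rw [← he, e.symm_apply_apply]
  have hB : IsIsotopy fun (t : unitInterval) y => boxReturn (c + (t : ℝ) • w) (e.symm y) :=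
    { continuous := by
        have := (isPushFunction_returnWalls hc).continuous
        have := e.symm.continuous
        unfold boxReturn
        fun_prop
      zero := fun y => by
        rw [Icc.coe_zero, zero_smul, add_zero, ← he, e.apply_symm_apply]
      homeomorph := fun t =>
        (isPushFunction_returnWalls (hmem t)).isHomeomorph.comp e.symm.isHomeomorph }
  refine ⟨_, (hB.comp (hφ.isIsotopy.conj e)).comp hK, fun t y hy => ?_, fun t y hy => ?_,
    fun y => ?_⟩
  · have : e.symm y = c + y := by rw [← hes (c + y), boxReturn_add hc hy]
    simp only [e.symm_apply_apply, hin t y hy, this, hφc y hy]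
    rw [mul_one, add_right_comm, boxReturn_add (hmem t) hy]
  · have : e.symm y = y := by
      conv_rhs => rw [← hes y, boxReturn_of_le_norm hc hy]
    simp only [e.symm_apply_apply, hout t y hy, this, hφ.support y hy]
    rw [mul_zero, zero_smul, add_zero, boxReturn_of_le_norm (hmem t) hy]
  · simp only [e.symm_apply_apply, hone, hes, Icc.coe_one, one_mul, one_smul]

theorem isBoxDrag_pushes {n : ℕ} (hn : n ≤ 6) : IsBoxDrag (boxCentre (n + 1)) (pushes n) := by
  induction n with
  | zero =>
    have h0 : boxCentre 1 = 0 := by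
      ext i
      fin_cases i <;> simp [boxCentre, knotVertex, whisker, axisVec]
    exact ⟨fun _ y => y, ⟨continuous_snd, fun _ => rfl, fun _ => .id⟩, fun _ _ _ => rfl,
      fun _ _ _ => rfl, fun y => by simp [h0, boxReturn, pushes]⟩
  | succ n ih =>
    have hm1 := boxCentre_mem_boxRange (i := n + 1) (by omega) (by omega)
    have hm2 := boxCentre_mem_boxRange (i := n + 2) (by omega) (by omega)
    have := (ih (by omega)).push hm1 (w := boxCentre (n + 2) - boxCentre (n + 1))
      (by rwa [add_sub_cancel]) (isPushFunction_pushFunction (by omega) hn)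
      (fun y hy => pushFunction_boxCentre_add (by omega) hn hy)
    rwa [add_sub_cancel] at this

/-- There is an isotopy of the cube of radius `16`, fixing a small box about the origin, which undoes
the six pushes. -/
theorem exists_isotopy_unknot :
    ∃ (K : unitInterval → (Fin 3 → ℝ) → Fin 3 → ℝ) (Φ : (Fin 3 → ℝ) ≃ₜ (Fin 3 → ℝ)),
      IsIsotopy K ∧ (∀ t y, ‖y‖ ≤ 1 / 1000 → K t y = y) ∧ (∀ t y, 16 ≤ ‖y‖ → K t y = y) ∧
      (∀ y, Φ y = pushes 6 y) ∧ ∀ y, K 1 (Φ y) = y := by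
  obtain ⟨K, hK, hin, hout, hone⟩ := isBoxDrag_pushes le_rfl
  have h0 : boxCentre 7 = 0 := by
    ext i
    fin_cases i <;> norm_num [boxCentre, knotVertex, whisker, axisVec]
  let Φ : (Fin 3 → ℝ) ≃ₜ (Fin 3 → ℝ) := (hK.homeomorph 1).homeomorph
  have hΦ : ∀ y, K 1 y = Φ y := fun y => rfl
  refine ⟨_, Φ, hK.reverse hΦ, fun t y hy => ?_, fun t y hy => ?_, fun y => ?_, fun y => ?_⟩
  · have : Φ.symm y = y := by rw [Φ.symm_apply_eq, ← hΦ, hin 1 y hy]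
    simp only [this, hin _ y hy]
  · have : Φ.symm y = y := by rw [Φ.symm_apply_eq, ← hΦ, hout 1 y hy]
    simp only [this, hout _ y hy]
  · rw [← hΦ, hone, h0, boxReturn, neg_zero, smul_zero, add_zero]
  · simp only [unitInterval.symm_one, Φ.symm_apply_apply, hK.zero]

/-! ### The trefoil strand -/

/-- At the right end `τ = 1` the floor in `trefoilStrand` jumps to the next edge, which starts there. -/
theorem trefoilStrand_div_seven (ε : ℝ) {i : ℕ} {τ : ℝ} (h0 : 0 ≤ τ) (h1 : τ ≤ 1) :
    trefoilStrand ε ((i + τ) / 7) =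
      AffineMap.lineMap (trefoilVertex ε i) (trefoilVertex ε (i + 1)) τ := by
  have h7 : 7 * (((i : ℝ) + τ) / 7) = i + τ := by ring
  rw [trefoilStrand, h7]
  rcases h1.eq_or_lt with rfl | h1
  · have : (i : ℝ) + 1 = ((i + 1 : ℕ) : ℝ) := by push_cast; ring
    rw [this, Nat.floor_natCast, Int.fract_natCast]
    simp
  · have hf : ⌊(i : ℝ) + τ⌋₊ = i := by
      rw [Nat.floor_eq_iff (by positivity)]
      constructor <;> linarith
    rw [hf, Int.fract_natCast_add, Int.fract_eq_self.2 ⟨h0, h1⟩]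

theorem exists_eq_div_seven {u : ℝ} (hu : u ∈ Icc (0 : ℝ) 1) :
    ∃ i ≤ 6, ∃ τ ∈ Icc (0 : ℝ) 1, u = ((i : ℕ) + τ) / 7 := by
  rcases hu.2.eq_or_lt with rfl | h1
  · exact ⟨6, le_rfl, 1, ⟨zero_le_one, le_rfl⟩, by norm_num⟩
  · have h7 : 0 ≤ 7 * u := by linarith [hu.1]
    refine ⟨⌊7 * u⌋₊, ?_, Int.fract (7 * u), ⟨Int.fract_nonneg _, (Int.fract_lt_one _).le⟩, ?_⟩
    · have : ⌊7 * u⌋₊ < 7 := (Nat.floor_lt h7).2 (by push_cast; linarith)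
      omega
    · rw [natCast_floor_eq_intCast_floor h7, Int.floor_add_fract]
      ring

/-- The right-handed strand, in coordinates. -/
def strandVec (u : ℝ) : Fin 3 → ℝ := (trefoilStrand 1 u).ofLp

/-- The abscissas of the points of the segment from `(-16,0,0)` to the origin that the pushes carry
to the vertices of the strand. -/
def vertexParam (i : ℕ) : ℝ := if i ≤ 6 then -whisker i else -2 / 100 + 1 / 899

theorem vertexParam_lt {i j : ℕ} (hij : i < j) (hj : j ≤ 7) : vertexParam i < vertexParam j := by
  interval_cases j <;> interval_cases i <;> norm_num [vertexParam, whisker]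

/-- The pushes bend a straight segment to the trefoil strand. -/
theorem pushes_vertexParam {i : ℕ} (hi : i ≤ 6) {τ : ℝ} (h0 : 0 ≤ τ) (h1 : τ ≤ 1) :
    pushes 6 (axisVec (vertexParam i + τ * (vertexParam (i + 1) - vertexParam i))) =
      strandVec ((i + τ) / 7) := by
  rw [strandVec, trefoilStrand_div_seven 1 h0 h1]
  have h := fun σ hσ => (pushes_axisVec le_rfl).1 i hi σ hσ
  rcases hi.lt_or_eq with hi | rfl
  · have : vertexParam i + τ * (vertexParam (i + 1) - vertexParam i) =
        -whisker i + τ * (whisker i - whisker (i + 1)) := by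
      rw [vertexParam, vertexParam, if_pos (by omega), if_pos (by omega)]
      ring
    rw [this, h τ ⟨h0, h1⟩]
    ext j
    interval_cases i <;> fin_cases j <;>
      simp [knotEdge, knotVertex, trefoilVertex, AffineMap.lineMap_apply] <;> ring
  · -- the last edge ends at `(-8,0,0)`, the edge laid out by the push at `(-1/100,0,0)`
    have : vertexParam 6 + τ * (vertexParam (6 + 1) - vertexParam 6) =
        -whisker 6 + τ * (100 / 899) * (whisker 6 - whisker (6 + 1)) := by
      simp [vertexParam, whisker]
      ring
    rw [this, h _ ⟨by positivity, by linarith⟩]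
    ext j
    fin_cases j <;> simp [knotEdge, knotVertex, trefoilVertex, AffineMap.lineMap_apply]
    ring

theorem axisVec_injective : Function.Injective axisVec := fun x y h => by
  simpa [axisVec] using congrFun h 0

theorem norm_axisVec (x : ℝ) : ‖axisVec x‖ = |x| := by
  refine le_antisymm ((pi_norm_le_iff_of_nonneg (abs_nonneg x)).2 fun i => ?_) ?_
  · fin_cases i <;> simp [axisVec]
  · simpa [axisVec] using norm_le_pi_norm (axisVec x) 0

/-- The strand is the image of a strictly increasing path on the axis under the pushes. -/
theorem injOn_strandVec (hinj : Function.Injective (pushes 6)) : InjOn strandVec (Icc 0 1) := by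
  have key : ∀ i ≤ 6, ∀ j ≤ 6, ∀ τ ∈ Icc (0 : ℝ) 1, ∀ σ ∈ Icc (0 : ℝ) 1, i ≤ j →
      vertexParam i + τ * (vertexParam (i + 1) - vertexParam i) =
        vertexParam j + σ * (vertexParam (j + 1) - vertexParam j) →
      ((i : ℕ) : ℝ) + τ = (j : ℕ) + σ := by
    intro i hi j hj τ hτ σ hσ hij h
    have hi' := vertexParam_lt (Nat.lt_succ_self i) (by omega)
    have hj' := vertexParam_lt (Nat.lt_succ_self j) (by omega)
    rw [Nat.succ_eq_add_one] at hi' hj'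
    rcases hij.eq_or_lt with rfl | hij
    · rw [mul_right_cancel₀ (sub_pos.2 hi').ne' (add_left_cancel h)]
    · have h1 := mul_nonneg (sub_nonneg.2 hτ.2) (sub_pos.2 hi').le
      have h2 := mul_nonneg hσ.1 (sub_pos.2 hj').le
      have hij' : j = i + 1 := by
        by_contra hne
        have := vertexParam_lt (show i + 1 < j by omega) (by omega)
        linarith
      subst hij'
      have hτ1 : (1 - τ) * (vertexParam (i + 1) - vertexParam i) = 0 := by linarith
      have hσ0 : σ * (vertexParam (i + 1 + 1) - vertexParam (i + 1)) = 0 := by linarith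
      rw [mul_eq_zero, or_iff_left (sub_pos.2 hi').ne'] at hτ1
      rw [mul_eq_zero, or_iff_left (sub_pos.2 hj').ne'] at hσ0
      push_cast
      linarith
  intro u hu v hv huv
  obtain ⟨i, hi, τ, hτ, rfl⟩ := exists_eq_div_seven hu
  obtain ⟨j, hj, σ, hσ, rfl⟩ := exists_eq_div_seven hv
  rw [← pushes_vertexParam hi hτ.1 hτ.2, ← pushes_vertexParam hj hσ.1 hσ.2] at huv
  have h := axisVec_injective (hinj huv)
  congr 1
  rcases le_total i j with hij | hij
  · exact key i hi j hj τ hτ σ hσ hij h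
  · exact (key j hj i hi σ hσ τ hτ hij h.symm).symm

/-- The pushes carry the segment from `(-16,0,0)` to the origin to the trefoil strand, prolonged to
the origin by a straight segment. -/
theorem pushes_image_axisVec :
    pushes 6 '' (axisVec '' Icc (-16) 0) =
      strandVec '' Icc 0 1 ∪ axisVec '' Icc (-8) 0 := by
  have hedge : ∀ τ ∈ Icc (0 : ℝ) 1, pushes 6 (axisVec (-2 / 100 + τ / 100)) =
      axisVec (-9 + τ * (899 / 100)) := by
    intro τ hτ
    have := (pushes_axisVec le_rfl).1 6 le_rfl τ hτ
    convert this using 2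
    · norm_num [whisker]; ring_nf
    · ext j
      fin_cases j <;> norm_num [knotEdge, knotVertex, axisVec]
  have hend : ∀ x ∈ Icc (-1 / 100 : ℝ) 0, pushes 6 (axisVec x) = axisVec x := by
    intro x hx
    have := (pushes_axisVec le_rfl).2 (x + 1 / 100)
      ⟨by linarith [hx.1], by norm_num [whisker]; linarith [hx.2]⟩
    convert this using 2
    · norm_num [whisker]
    · ext j
      fin_cases j <;> norm_num [knotVertex, axisVec]
  have hmono : ∀ i ≤ 6, -16 ≤ vertexParam i ∧ vertexParam (i + 1) ≤ 0 := fun i hi => by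
    interval_cases i <;> norm_num [vertexParam, whisker]
  have hcover : ∀ n ≤ 7, ∀ x, vertexParam 0 ≤ x → x ≤ vertexParam n →
      x = vertexParam 0 ∨ ∃ i < n, vertexParam i ≤ x ∧ x ≤ vertexParam (i + 1) := by
    intro n
    induction n with
    | zero => exact fun _ x h0 h => .inl (le_antisymm h h0)
    | succ n ih =>
      intro hn x h0 h
      rcases le_total x (vertexParam n) with hx | hx
      · rcases ih (by omega) x h0 hx with h' | ⟨i, hi, h'⟩
        · exact .inl h'
        · exact .inr ⟨i, by omega, h'⟩
      · exact .inr ⟨n, by omega, hx, h⟩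
  refine Subset.antisymm ?_ ?_
  · rintro _ ⟨_, ⟨x, hx, rfl⟩, rfl⟩
    have h0 : vertexParam 0 = -16 := by norm_num [vertexParam, whisker]
    have h7 : vertexParam 7 = -2 / 100 + 1 / 899 := by norm_num [vertexParam]
    rcases le_total x (vertexParam 7) with hx7 | hx7
    · have hc : ∃ i < 7, vertexParam i ≤ x ∧ x ≤ vertexParam (i + 1) := by
        rcases hcover 7 le_rfl x (by rw [h0]; exact hx.1) hx7 with h | h
        · exact ⟨0, by norm_num, h.ge, h.le.trans (vertexParam_lt one_pos (by norm_num)).le⟩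
        · exact h
      obtain ⟨i, hi, h1, h2⟩ := hc
      have hlt := sub_pos.2 (vertexParam_lt (Nat.lt_succ_self i) (by omega))
      rw [Nat.succ_eq_add_one] at hlt
      have hx : x = vertexParam i + (x - vertexParam i) / (vertexParam (i + 1) - vertexParam i) *
          (vertexParam (i + 1) - vertexParam i) := by
        rw [div_mul_cancel₀ _ hlt.ne']; ring
      have hτ0 : 0 ≤ (x - vertexParam i) / (vertexParam (i + 1) - vertexParam i) :=
        div_nonneg (by linarith) hlt.le
      have hτ1 : (x - vertexParam i) / (vertexParam (i + 1) - vertexParam i) ≤ 1 :=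
        (div_le_one hlt).2 (by linarith)
      rw [hx, pushes_vertexParam (by omega) hτ0 hτ1]
      have : (i : ℝ) ≤ 6 := by exact_mod_cast Nat.lt_succ_iff.1 hi
      exact .inl ⟨_, ⟨by positivity, by linarith⟩, rfl⟩
    · rw [h7] at hx7
      right
      rcases le_total x (-1 / 100) with hx1 | hx1
      · have h : x = -2 / 100 + (100 * x + 2) / 100 := by ring
        rw [h, hedge _ ⟨by linarith, by linarith⟩]
        exact ⟨_, ⟨by linarith, by linarith⟩, rfl⟩
      · rw [hend x ⟨hx1, hx.2⟩]
        exact ⟨x, ⟨by linarith, hx.2⟩, rfl⟩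
  · rintro _ (⟨u, hu, rfl⟩ | ⟨x, hx, rfl⟩)
    · obtain ⟨i, hi, τ, hτ, rfl⟩ := exists_eq_div_seven hu
      rw [← pushes_vertexParam hi hτ.1 hτ.2]
      have hlt := sub_pos.2 (vertexParam_lt (Nat.lt_succ_self i) (by omega))
      rw [Nat.succ_eq_add_one] at hlt
      have h1 := mul_nonneg hτ.1 hlt.le
      have h2 := mul_nonneg (sub_nonneg.2 hτ.2) hlt.le
      exact ⟨_, ⟨_, ⟨by linarith [(hmono i hi).1], by linarith [(hmono i hi).2]⟩, rfl⟩, rfl⟩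
    · rcases le_total x (-1 / 100) with hx1 | hx1
      · have h : x = -9 + ((x + 9) * (100 / 899)) * (899 / 100) := by ring
        rw [h, ← hedge _ ⟨by linarith [hx.1], by linarith⟩]
        exact ⟨_, ⟨_, ⟨by linarith [hx.1], by linarith⟩, rfl⟩, rfl⟩
      · exact ⟨_, ⟨x, ⟨by linarith, hx.2⟩, rfl⟩, hend x ⟨hx1, hx.2⟩⟩

theorem norm_eq_neg_apply_zero {y : Fin 3 → ℝ} (h1 : |y 1| ≤ -y 0) (h2 : |y 2| ≤ -y 0) :
    ‖y‖ = -y 0 := by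
  have h0 : 0 ≤ -y 0 := (abs_nonneg _).trans h1
  refine le_antisymm ((pi_norm_le_iff_of_nonneg h0).2 ?_) ?_
  · simp only [Fin.forall_fin_succ, Real.norm_eq_abs]
    exact ⟨(abs_of_nonpos (by linarith)).le, h1, h2, fun i => i.elim0⟩
  · exact (neg_le_abs _).trans (norm_le_pi_norm y 0)

/-- The strand stays in a cone about the negative first axis, where the sup norm is the negative of the first
coordinate. -/
theorem strandVec_bounds {u : ℝ} (hu : u ∈ Icc (0 : ℝ) 1) :
    (-16 ≤ strandVec u 0 ∧ strandVec u 0 ≤ -8) ∧ ‖strandVec u‖ = -strandVec u 0 ∧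
    (strandVec u 0 = -8 → u = 1) ∧
    (-9 ≤ strandVec u 0 → ∃ x ∈ Icc (-9 : ℝ) (-8), strandVec u = axisVec x) := by
  obtain ⟨i, hi, τ, hτ, rfl⟩ := exists_eq_div_seven hu
  obtain ⟨h0, h1⟩ := hτ
  have hv : ∀ j, strandVec ((i + τ) / 7) j = (trefoilVertex 1 i).ofLp j +
      τ * ((trefoilVertex 1 (i + 1)).ofLp j - (trefoilVertex 1 i).ofLp j) := by
    intro j
    rw [strandVec, trefoilStrand_div_seven 1 h0 h1]
    simp [AffineMap.lineMap_apply, add_comm]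
  have hb : (-16 ≤ strandVec ((i + τ) / 7) 0 ∧ strandVec ((i + τ) / 7) 0 ≤ -8) ∧
      |strandVec ((i + τ) / 7) 1| ≤ -strandVec ((i + τ) / 7) 0 ∧
      |strandVec ((i + τ) / 7) 2| ≤ -strandVec ((i + τ) / 7) 0 := by
    simp only [hv, abs_le]
    refine ⟨⟨?_, ?_⟩, ⟨?_, ?_⟩, ?_, ?_⟩ <;> interval_cases i <;> simp [trefoilVertex] <;> linarith
  refine ⟨hb.1, norm_eq_neg_apply_zero hb.2.1 hb.2.2, fun h => ?_, fun h => ?_⟩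
  · rw [hv] at h
    interval_cases i <;> simp [trefoilVertex] at h ⊢ <;> linarith
  · refine ⟨strandVec ((i + τ) / 7) 0, ⟨h, hb.1.2⟩, ?_⟩
    rw [hv] at h
    ext j
    fin_cases j <;> simp only [axisVec, hv] <;> interval_cases i <;> simp [trefoilVertex] at h ⊢ <;>
      linarith

/-! ### Shrinking the inner cube -/

section Shrink

variable {E : Type*} [NormedAddCommGroup E] [NormedSpace ℝ E]

/-- The factor by which `shrink` scales the vectors of norm `n`. -/
def shrinkFactor (n : ℝ) : ℝ := 1 / 8000 + 7999 / 8000 * max 0 (min 1 (n - 8))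

/-- A radial map that shrinks the ball of radius `8` to the ball of radius `1 / 1000` and is the
identity outside the ball of radius `9`. -/
def shrink (y : E) : E := shrinkFactor ‖y‖ • y

theorem shrinkFactor_of_le {n : ℝ} (hn : n ≤ 8) : shrinkFactor n = 1 / 8000 := by
  rw [shrinkFactor, max_eq_left ((min_le_right _ _).trans (by linarith))]
  norm_num

theorem shrinkFactor_of_ge {n : ℝ} (hn : 9 ≤ n) : shrinkFactor n = 1 := by
  rw [shrinkFactor, min_eq_left (by linarith)]
  norm_num

theorem shrinkFactor_pos (n : ℝ) : 0 < shrinkFactor n := by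
  have := le_max_left 0 (min 1 (n - 8))
  rw [shrinkFactor]
  linarith

theorem shrinkFactor_le_one (n : ℝ) : shrinkFactor n ≤ 1 := by
  have : max 0 (min 1 (n - 8)) ≤ 1 := max_le zero_le_one (min_le_left _ _)
  rw [shrinkFactor]
  linarith

theorem monotone_shrinkFactor : Monotone shrinkFactor := fun m n h => by
  have : max 0 (min 1 (m - 8)) ≤ max 0 (min 1 (n - 8)) :=
    max_le_max le_rfl (min_le_min le_rfl (by linarith))
  simp only [shrinkFactor]
  linarith

theorem continuous_shrinkFactor : Continuous shrinkFactor := by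
  unfold shrinkFactor
  fun_prop

theorem strictMonoOn_shrinkFactor_mul : StrictMonoOn (fun n => shrinkFactor n * n) (Ici 0) :=
  fun m hm _ _ h =>
    (mul_lt_mul_of_pos_left h (shrinkFactor_pos m)).trans_le
      (mul_le_mul_of_nonneg_right (monotone_shrinkFactor h.le) ((mem_Ici.1 hm).trans h.le))

theorem norm_shrink (y : E) : ‖shrink y‖ = shrinkFactor ‖y‖ * ‖y‖ := by
  rw [shrink, norm_smul, Real.norm_of_nonneg (shrinkFactor_pos _).le]

theorem norm_shrink_lt_iff {y : E} : ‖shrink y‖ < 1 / 1000 ↔ ‖y‖ < 8 := by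
  have h8 : shrinkFactor 8 * 8 = 1 / 1000 := by rw [shrinkFactor_of_le le_rfl]; norm_num
  rw [norm_shrink, ← h8]
  exact strictMonoOn_shrinkFactor_mul.lt_iff_lt (norm_nonneg y) (by norm_num : (0 : ℝ) ≤ 8)

theorem shrink_of_le_norm {y : E} (hy : 9 ≤ ‖y‖) : shrink y = y := by
  rw [shrink, shrinkFactor_of_ge hy, one_smul]

theorem norm_shrink_le_of_norm_le {y : E} (hy : ‖y‖ ≤ 8) : ‖shrink y‖ ≤ 1 / 1000 := by
  rw [norm_shrink, shrinkFactor_of_le hy]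
  linarith

theorem isHomeomorph_shrink [ProperSpace E] : IsHomeomorph (shrink : E → E) := by
  refine isHomeomorph_of_eq_id_of_le_norm ?_ ⟨fun y z h => ?_, fun z => ?_⟩
    (R := 9) fun y => shrink_of_le_norm
  · exact (continuous_shrinkFactor.comp continuous_norm).smul continuous_id
  · have hn : ‖y‖ = ‖z‖ := by
      refine strictMonoOn_shrinkFactor_mul.injOn (norm_nonneg y) (norm_nonneg z) ?_
      simp only [← norm_shrink, h]
    rw [shrink, shrink, hn] at h
    exact (smul_right_inj (shrinkFactor_pos _).ne').1 h
  · have hc : ContinuousOn (fun n => shrinkFactor n * n) (Icc 0 (‖z‖ + 9)) :=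
      (continuous_shrinkFactor.mul continuous_id).continuousOn
    obtain ⟨n, hn, h⟩ := intermediate_value_Icc (by positivity) hc (show ‖z‖ ∈ Icc _ _ by
      rw [mul_zero, shrinkFactor_of_ge (by linarith [norm_nonneg z]), one_mul]
      exact ⟨norm_nonneg z, by linarith⟩)
    have hpos := shrinkFactor_pos n
    have hnorm : ‖(shrinkFactor n)⁻¹ • z‖ = n := by
      rw [norm_smul, Real.norm_of_nonneg (inv_nonneg.2 hpos.le), ← h]
      field_simp
    exact ⟨(shrinkFactor n)⁻¹ • z, by rw [shrink, hnorm, smul_inv_smul₀ hpos.ne']⟩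

end Shrink

theorem shrink_mem_iff {X : Set (Fin 3 → ℝ)}
    (hX : ∀ y, ‖y‖ ≤ 9 → (y ∈ X ↔ y ∈ axisVec '' Icc (-9) 0)) (y : Fin 3 → ℝ) :
    shrink y ∈ X ↔ y ∈ X := by
  rcases le_total 9 ‖y‖ with hy | hy
  · rw [shrink_of_le_norm hy]
  have hpos := shrinkFactor_pos ‖y‖
  have hle : ‖shrink y‖ ≤ ‖y‖ := by
    rw [norm_shrink]
    exact mul_le_of_le_one_left (norm_nonneg y) (shrinkFactor_le_one _)
  rw [hX _ (hle.trans hy), hX _ hy]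
  constructor
  · rintro ⟨x, hx, h⟩
    have hyx : y = axisVec ((shrinkFactor ‖y‖)⁻¹ * x) := by
      rw [axisVec_eq_smul, mul_smul, ← axisVec_eq_smul, h, shrink, inv_smul_smul₀ hpos.ne']
    refine ⟨_, ⟨?_, mul_nonpos_of_nonneg_of_nonpos (inv_nonneg.2 hpos.le) hx.2⟩, hyx.symm⟩
    rw [hyx, norm_axisVec] at hy
    exact (abs_le.1 hy).1
  · rintro ⟨x, hx, h⟩
    have h1 := shrinkFactor_le_one ‖y‖
    refine ⟨shrinkFactor ‖y‖ * x, ⟨by nlinarith [hx.1, hx.2],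
      mul_nonpos_of_nonneg_of_nonpos hpos.le hx.2⟩, ?_⟩
    rw [axisVec_eq_smul, mul_smul, ← axisVec_eq_smul, h, shrink]

/-! ### Straightening one strand -/

theorem injective_pushes : Function.Injective (pushes 6) := by
  obtain ⟨-, Φ, -, -, -, hΦ, -⟩ := exists_isotopy_unknot
  rw [← funext hΦ]
  exact Φ.injective

/-- The strand can be pulled straight in the region between the cubes of radius `8` and `16`. -/
theorem exists_isotopy_straighten :
    ∃ H : unitInterval → (Fin 3 → ℝ) → Fin 3 → ℝ, IsIsotopy H ∧
      (∀ t y, ‖y‖ ≤ 8 ∨ 16 ≤ ‖y‖ → H t y = y) ∧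
      H 1 '' (strandVec '' Icc 0 1) = axisVec '' Icc (-16) (-8) := by
  obtain ⟨K, Φ, hK, hin, hout, hΦ, hone⟩ := exists_isotopy_unknot
  let m : (Fin 3 → ℝ) ≃ₜ (Fin 3 → ℝ) := isHomeomorph_shrink.homeomorph
  have hm : ∀ y, m y = shrink y := fun y => rfl
  -- the two sets, prolonged to the origin, are preserved by `shrink`
  have hS : ∀ y, m y ∈ axisVec '' Icc (-16) 0 ↔ y ∈ axisVec '' Icc (-16) 0 := by
    refine shrink_mem_iff fun y hy => ⟨?_, fun h => image_mono (Icc_subset_Icc_left (by norm_num)) h⟩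
    rintro ⟨x, hx, rfl⟩
    rw [norm_axisVec] at hy
    exact ⟨x, ⟨(abs_le.1 hy).1, hx.2⟩, rfl⟩
  have hT : ∀ y, m y ∈ strandVec '' Icc 0 1 ∪ axisVec '' Icc (-8) 0 ↔
      y ∈ strandVec '' Icc 0 1 ∪ axisVec '' Icc (-8) 0 := by
    refine shrink_mem_iff fun y hy => ⟨?_, ?_⟩
    · rintro (⟨u, hu, rfl⟩ | h)
      · obtain ⟨-, hn, -, hx⟩ := strandVec_bounds hu
        obtain ⟨x, hx, h⟩ := hx (by linarith)
        exact ⟨x, ⟨hx.1, hx.2.trans (by norm_num)⟩, h.symm⟩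
      · exact image_mono (Icc_subset_Icc_left (by norm_num)) h
    · rintro ⟨x, hx, rfl⟩
      rcases le_total x (-8) with h8 | h8
      · refine .inl ⟨((6 : ℕ) + (x + 9)) / 7, ⟨?_, ?_⟩, ?_⟩
        · push_cast; linarith [hx.1]
        · push_cast; linarith
        · rw [strandVec, trefoilStrand_div_seven 1 (by linarith [hx.1]) (by linarith)]
          ext j
          fin_cases j <;> simp [trefoilVertex, axisVec, AffineMap.lineMap_apply]
          ring
      · exact .inr ⟨x, ⟨h8, hx.2⟩, rfl⟩
  have hS8 : ∀ y, y ∈ axisVec '' Icc (-16) (-8) ↔ y ∈ axisVec '' Icc (-16) 0 ∧ ¬‖y‖ < 8 := by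
    intro y
    constructor
    · rintro ⟨x, hx, rfl⟩
      rw [norm_axisVec, not_lt]
      exact ⟨⟨x, ⟨hx.1, hx.2.trans (by norm_num)⟩, rfl⟩, by linarith [neg_le_abs x, hx.2]⟩
    · rintro ⟨⟨x, hx, rfl⟩, h⟩
      rw [norm_axisVec, not_lt, abs_of_nonpos hx.2] at h
      exact ⟨x, ⟨hx.1, by linarith⟩, rfl⟩
  have hT8 : ∀ y, y ∈ strandVec '' Icc 0 1 ↔
      y ∈ strandVec '' Icc 0 1 ∪ axisVec '' Icc (-8) 0 ∧ ¬‖y‖ < 8 := by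
    intro y
    constructor
    · rintro ⟨u, hu, rfl⟩
      obtain ⟨hb, hn, -⟩ := strandVec_bounds hu
      exact ⟨.inl ⟨u, hu, rfl⟩, by rw [hn]; linarith [hb.2]⟩
    · rintro ⟨h | ⟨x, hx, rfl⟩, h8⟩
      · exact h
      · rw [norm_axisVec, not_lt, abs_of_nonpos hx.2] at h8
        obtain rfl : x = -8 := by linarith [hx.1]
        refine ⟨((6 : ℕ) + 1) / 7, ⟨by norm_num, by norm_num⟩, ?_⟩
        rw [strandVec, trefoilStrand_div_seven 1 zero_le_one le_rfl]
        ext j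
        fin_cases j <;> simp [trefoilVertex, axisVec]
  have hΦT : ∀ y, Φ y ∈ strandVec '' Icc 0 1 ∪ axisVec '' Icc (-8) 0 ↔
      y ∈ axisVec '' Icc (-16) 0 := by
    intro y
    rw [← pushes_image_axisVec, ← funext hΦ, Φ.injective.mem_set_image]
  have hΦin : ∀ y, ‖Φ y‖ < 1 / 1000 ↔ ‖y‖ < 1 / 1000 := by
    have hfix : ∀ y, ‖y‖ < 1 / 1000 → Φ y = y := fun y hy =>
      (hK.homeomorph 1).injective ((hone y).trans (hin 1 y hy.le).symm)
    refine fun y => ⟨fun h => ?_, fun h => by rwa [hfix y h]⟩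
    rwa [← Φ.injective (hfix _ h)]
  have key : ∀ y, m.symm (Φ (m y)) ∈ strandVec '' Icc 0 1 ↔ y ∈ axisVec '' Icc (-16) (-8) := by
    intro y
    rw [hT8, ← norm_shrink_lt_iff, ← hT, ← hm, m.apply_symm_apply, hΦT, hΦin, hS, hm,
      norm_shrink_lt_iff, hS8]
  refine ⟨_, hK.conj m.symm, fun t y hy => ?_, ?_⟩
  · have : K t (m y) = m y := by
      rcases hy with hy | hy
      · exact hin t _ (norm_shrink_le_of_norm_le hy)
      · exact hout t _ (by rwa [hm, shrink_of_le_norm (by linarith)])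
    simp only [m.symm_symm, this, m.symm_apply_apply]
  · have hinv : ∀ y, m.symm (K 1 (m.symm.symm (m.symm (Φ (m y))))) = y := fun y => by
      rw [m.symm_symm, m.apply_symm_apply, hone, m.symm_apply_apply]
    refine Subset.antisymm ?_ fun y hy => ⟨_, (key y).2 hy, hinv y⟩
    rintro _ ⟨z, hz, rfl⟩
    obtain ⟨y, rfl⟩ : ∃ y, m.symm (Φ (m y)) = z := ⟨m.symm (Φ.symm (m z)), by simp⟩
    simp only [hinv]
    exact (key y).1 hz

/-! ### From the right-handed strand to the `k`-th trefoil -/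

theorem units_mul_self (ε : ℤˣ) : ((ε : ℤ) : ℝ) * ((ε : ℤ) : ℝ) = 1 := by
  rcases Int.units_eq_one_or ε with rfl | rfl <;> simp

theorem abs_units (ε : ℤˣ) : |((ε : ℤ) : ℝ)| = 1 := by
  rcases Int.units_eq_one_or ε with rfl | rfl <;> simp

/-- Scaling by `2⁻ᵏ`, combined with the reflection in the `xy`-plane if `ε = -1`. It carries the
cubes of radius `16` and `8` to `box k` and `box (k + 1)`. -/
def shellHomeo (ε : ℤˣ) (k : ℕ) : (Fin 3 → ℝ) ≃ₜ E3 where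
  toFun y := !₂[(1 / 2) ^ k * y 0, (1 / 2) ^ k * y 1, (1 / 2) ^ k * (((ε : ℤ) : ℝ) * y 2)]
  invFun p := ![2 ^ k * p 0, 2 ^ k * p 1, 2 ^ k * (((ε : ℤ) : ℝ) * p 2)]
  left_inv y := by
    have h2 : (2 : ℝ) ^ k * (1 / 2) ^ k = 1 := by rw [← mul_pow]; norm_num
    ext i
    fin_cases i
    · simp only [Fin.zero_eta, Matrix.cons_val]; linear_combination y 0 * h2
    · simp only [Fin.mk_one, Matrix.cons_val]; linear_combination y 1 * h2
    · simp only [Fin.reduceFinMk, Matrix.cons_val]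
      linear_combination y 2 * ((ε : ℤ) : ℝ) * ((ε : ℤ) : ℝ) * h2 + y 2 * units_mul_self ε
  right_inv p := by
    have h2 : (2 : ℝ) ^ k * (1 / 2) ^ k = 1 := by rw [← mul_pow]; norm_num
    ext i
    fin_cases i
    · simp only [Fin.zero_eta, Matrix.cons_val]; linear_combination p 0 * h2
    · simp only [Fin.mk_one, Matrix.cons_val]; linear_combination p 1 * h2
    · simp only [Fin.reduceFinMk, Matrix.cons_val]
      linear_combination p 2 * ((ε : ℤ) : ℝ) * ((ε : ℤ) : ℝ) * h2 + p 2 * units_mul_self ε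
  continuous_toFun := by fun_prop
  continuous_invFun := by fun_prop

theorem shellHomeo_apply (ε : ℤˣ) (k : ℕ) (y : Fin 3 → ℝ) : shellHomeo ε k y =
    !₂[(1 / 2) ^ k * y 0, (1 / 2) ^ k * y 1, (1 / 2) ^ k * (((ε : ℤ) : ℝ) * y 2)] := rfl

theorem abs_shellHomeo_apply (ε : ℤˣ) (k : ℕ) (y : Fin 3 → ℝ) (i : Fin 3) :
    |shellHomeo ε k y i| = (1 / 2) ^ k * |y i| := by
  have h2 : (0 : ℝ) ≤ (1 / 2) ^ k := by positivity
  fin_cases i <;> simp [shellHomeo_apply, abs_mul, abs_units]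

theorem shellHomeo_mem_box_iff {ε : ℤˣ} {k n : ℕ} {y : Fin 3 → ℝ} :
    shellHomeo ε k y ∈ box (k + n) ↔ ‖y‖ ≤ 16 * (1 / 2) ^ n := by
  have h2 : (0 : ℝ) < (1 / 2) ^ k := by positivity
  simp only [box, mem_ofPred_eq, abs_shellHomeo_apply, pow_add]
  rw [pi_norm_le_iff_of_nonneg (by positivity)]
  refine forall_congr' fun i => ?_
  rw [Real.norm_eq_abs, mul_left_comm, mul_le_mul_iff_right₀ h2]

theorem shellHomeo_mem_shell_iff {ε : ℤˣ} {k : ℕ} {y : Fin 3 → ℝ} :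
    shellHomeo ε k y ∈ shell k ↔ ‖y‖ ≤ 16 ∧ 8 < ‖y‖ := by
  have h0 := shellHomeo_mem_box_iff (ε := ε) (k := k) (n := 0) (y := y)
  have h1 := shellHomeo_mem_box_iff (ε := ε) (k := k) (n := 1) (y := y)
  rw [pow_zero, mul_one, add_zero] at h0
  rw [pow_one, show (16 : ℝ) * (1 / 2) = 8 by norm_num] at h1
  rw [shell, Set.mem_sdiff, h0, h1, not_le]

theorem shellHomeo_axisVec (ε : ℤˣ) (k : ℕ) (x : ℝ) :
    shellHomeo ε k (axisVec x) = axisPoint ((1 / 2) ^ k * x) := by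
  simp [shellHomeo_apply, axisVec, axisPoint]

theorem trefoilVertex_eq (ε : ℝ) (i : ℕ) : trefoilVertex ε i =
    !₂[trefoilVertex 1 i 0, trefoilVertex 1 i 1, ε * trefoilVertex 1 i 2] := by
  rcases i with _ | _ | _ | _ | _ | _ | _ | i <;> simp [trefoilVertex, mul_comm]

theorem shellHomeo_strandVec (ε : ℤˣ) (k : ℕ) (u : ℝ) :
    shellHomeo ε k (strandVec u) = (1 / 2 : ℝ) ^ k • trefoilStrand ((ε : ℤ) : ℝ) u := by
  rw [trefoilStrand, trefoilVertex_eq _ ⌊7 * u⌋₊, trefoilVertex_eq _ (⌊7 * u⌋₊ + 1),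
    shellHomeo_apply]
  ext j
  fin_cases j <;> simp [strandVec, trefoilStrand, AffineMap.lineMap_apply] <;> ring

theorem axisPoint_eq_smul (x : ℝ) : axisPoint x = x • axisPoint 1 := by
  ext i; fin_cases i <;> simp [axisPoint]

theorem axisPoint_image_Icc {a b : ℝ} (h : a ≤ b) :
    axisPoint '' Icc a b = segment ℝ (axisPoint a) (axisPoint b) := by
  let L : ℝ →ₗ[ℝ] E3 := LinearMap.toSpanSingleton ℝ E3 (axisPoint 1)
  have hL : axisPoint = L := funext fun x => by
    rw [axisPoint_eq_smul, LinearMap.toSpanSingleton_apply]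
  rw [hL, ← segment_eq_Icc h]
  exact image_segment ℝ L.toAffineMap a b

/-! ### The infinite sum of trefoils is an arc -/

/-- On the `k`-th parameter interval, including its right end, `trefoilSum` is the `k`-th trefoil. -/
theorem trefoilSum_eq (ε : ℕ → ℤˣ) (k : ℕ) {u : ℝ} (hu : u ∈ Icc (0 : ℝ) 1) {t : unitInterval}
    (ht : (t : ℝ) = 1 - (1 / 2) ^ k * (1 - u / 2)) :
    trefoilSum ε t = shellHomeo (ε k) k (strandVec u) := by
  have main : ∀ (k : ℕ) (u : ℝ), 0 ≤ u → u < 1 → (t : ℝ) = 1 - (1 / 2) ^ k * (1 - u / 2) →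
      trefoilSum ε t = shellHomeo (ε k) k (strandVec u) := by
    intro k u h0 h1 ht
    have h2 : (0 : ℝ) < (1 / 2) ^ k := by positivity
    have h22 : (2 : ℝ) ^ k * (1 / 2) ^ k = 1 := by rw [← mul_pow]; norm_num
    have hpos : (0 : ℝ) < 1 - u / 2 := by linarith
    have h1t : 1 - (t : ℝ) = (1 / 2) ^ k * (1 - u / 2) := by rw [ht]; ring
    have hlog : Nat.log 2 ⌊1 / (1 - (t : ℝ))⌋₊ = k := by
      have hp : 0 < 1 - (t : ℝ) := by rw [h1t]; positivity
      refine Nat.log_eq_of_pow_le_of_lt_pow (Nat.le_floor ?_)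
        ((Nat.floor_lt (by positivity)).2 ?_)
      · push_cast
        rw [le_div_iff₀ hp, h1t]
        nlinarith
      · push_cast
        rw [div_lt_iff₀ hp, h1t, pow_succ]
        nlinarith
    have hne : (t : ℝ) ≠ 1 := by
      have : 0 < 1 - (t : ℝ) := by rw [h1t]; positivity
      linarith
    have hu : 2 - 2 ^ (k + 1) * (1 - (t : ℝ)) = u := by
      rw [h1t, pow_succ]
      linear_combination (u - 2) * h22
    simp only [trefoilSum, if_neg hne, hlog, hu, shellHomeo_strandVec]
  rcases hu.2.eq_or_lt with rfl | h1
  · -- here the formula defining `trefoilSum` refers to the start of the next trefoil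
    rw [main (k + 1) 0 le_rfl one_pos (by rw [ht, pow_succ]; ring)]
    have h0 := trefoilStrand_div_seven 1 (i := 0) (τ := 0) le_rfl zero_le_one
    have h1 := trefoilStrand_div_seven 1 (i := 6) (τ := 1) zero_le_one le_rfl
    norm_num at h0 h1
    rw [shellHomeo_apply, shellHomeo_apply, strandVec, strandVec, h0, h1]
    ext j
    fin_cases j <;> simp [trefoilVertex, pow_succ]
    ring
  · exact main k u hu.1 h1 ht

theorem exists_eq_one_sub {t : unitInterval} (ht : t ≠ 1) :
    ∃ (k : ℕ) (u : ℝ), 0 ≤ u ∧ u < 1 ∧ (t : ℝ) = 1 - (1 / 2) ^ k * (1 - u / 2) := by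
  have ht1 : 0 < 1 - (t : ℝ) := sub_pos.2 (lt_of_le_of_ne t.2.2 fun h => ht (Subtype.ext h))
  obtain ⟨k, h1, h2⟩ := exists_nat_pow_near (x := 1 / (1 - (t : ℝ))) (y := 2)
    ((one_le_div ht1).2 (by linarith [t.2.1])) one_lt_two
  rw [le_div_iff₀ ht1] at h1
  rw [div_lt_iff₀ ht1] at h2
  have h22 : (1 / 2) ^ k * (2 : ℝ) ^ k = 1 := by rw [← mul_pow]; norm_num
  refine ⟨k, 2 - 2 ^ (k + 1) * (1 - t), ?_, by linarith, ?_⟩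
  · rw [pow_succ]; linarith
  · rw [pow_succ]; linear_combination (1 - (t : ℝ)) * h22

theorem trefoilSum_one (ε : ℕ → ℤˣ) : trefoilSum ε 1 = 0 := by simp [trefoilSum]

theorem trefoilPiece_eq (ε : ℕ → ℤˣ) (k : ℕ) :
    trefoilPiece ε k = shellHomeo (ε k) k '' (strandVec '' Icc 0 1) := by
  have h2 : (0 : ℝ) < (1 / 2) ^ k := by positivity
  have h2' : (1 / 2 : ℝ) ^ k ≤ 1 := pow_le_one₀ (by norm_num) (by norm_num)
  have h22 : (1 / 2) ^ k * (2 : ℝ) ^ k = 1 := by rw [← mul_pow]; norm_num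
  have h2p : (0 : ℝ) < 2 ^ k := by positivity
  refine Subset.antisymm ?_ ?_
  · rintro _ ⟨t, ⟨h0, h1⟩, rfl⟩
    rw [pow_succ] at h1
    refine ⟨_, ⟨2 - 2 ^ (k + 1) * (1 - t), ⟨?_, ?_⟩, rfl⟩, (trefoilSum_eq ε k ⟨?_, ?_⟩ ?_).symm⟩
    rotate_left 4
    · rw [pow_succ]; linear_combination (1 - (t : ℝ)) * h22
    all_goals rw [pow_succ]; nlinarith
  · rintro _ ⟨_, ⟨u, hu, rfl⟩, rfl⟩
    refine ⟨⟨1 - (1 / 2) ^ k * (1 - u / 2), ?_, ?_⟩, ⟨?_, ?_⟩, trefoilSum_eq ε k hu rfl⟩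
    · nlinarith [hu.1]
    · nlinarith [hu.2]
    · show _ ≤ 1 - (1 / 2 : ℝ) ^ k * (1 - u / 2)
      nlinarith [hu.1]
    · show 1 - (1 / 2 : ℝ) ^ k * (1 - u / 2) ≤ _
      rw [pow_succ]
      nlinarith [hu.2]

theorem trefoilSum_apply_zero_bounds (ε : ℕ → ℤˣ) {k : ℕ} {u : ℝ} (h0 : 0 ≤ u) (h1 : u < 1)
    {t : unitInterval} (ht : (t : ℝ) = 1 - (1 / 2) ^ k * (1 - u / 2)) :
    -(16 * (1 / 2) ^ k) ≤ trefoilSum ε t 0 ∧ trefoilSum ε t 0 < -(16 * (1 / 2) ^ (k + 1)) := by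
  have h2 : (0 : ℝ) < (1 / 2) ^ k := by positivity
  obtain ⟨⟨hl, hr⟩, -, hone, -⟩ := strandVec_bounds ⟨h0, h1.le⟩
  have hr : strandVec u 0 < -8 := lt_of_le_of_ne hr fun h => h1.ne (hone h)
  rw [trefoilSum_eq ε k ⟨h0, h1.le⟩ ht, shellHomeo_apply]
  simp only [Matrix.cons_val, pow_succ]
  constructor <;> nlinarith

theorem injective_trefoilSum (ε : ℕ → ℤˣ) : Function.Injective (trefoilSum ε) := by
  have hne : ∀ t, t ≠ 1 → trefoilSum ε t ≠ 0 := by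
    intro t ht h
    obtain ⟨k, u, h0, h1, htu⟩ := exists_eq_one_sub ht
    have := (trefoilSum_apply_zero_bounds ε h0 h1 htu).2
    have h2 : (0 : ℝ) < (1 / 2) ^ (k + 1) := by positivity
    simp only [h, PiLp.zero_apply] at this
    linarith
  -- otherwise the first coordinate determines the index of the trefoil
  intro s t hst
  by_cases hs : s = 1
  · by_contra h
    exact hne t (fun ht => h (hs.trans ht.symm)) (by rw [← hst, hs, trefoilSum_one])
  by_cases ht : t = 1
  · exact absurd (by rw [hst, ht, trefoilSum_one]) (hne s hs)
  obtain ⟨j, u, hu0, hu1, hs⟩ := exists_eq_one_sub hs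
  obtain ⟨k, v, hv0, hv1, ht⟩ := exists_eq_one_sub ht
  have hbs := trefoilSum_apply_zero_bounds ε hu0 hu1 hs
  have hbt := trefoilSum_apply_zero_bounds ε hv0 hv1 ht
  have hanti : ∀ {m n : ℕ}, m ≤ n → (1 / 2 : ℝ) ^ n ≤ (1 / 2) ^ m := fun h =>
    pow_le_pow_of_le_one (by norm_num) (by norm_num) h
  rw [hst] at hbs
  have hjk : j = k := by
    rcases lt_trichotomy j k with h | h | h
    · have := hanti (m := j + 1) h; linarith [hbs.2, hbt.1]
    · exact h
    · have := hanti (m := k + 1) h; linarith [hbt.2, hbs.1]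
  subst hjk
  rw [trefoilSum_eq ε j ⟨hu0, hu1.le⟩ hs, trefoilSum_eq ε j ⟨hv0, hv1.le⟩ ht] at hst
  have := injOn_strandVec injective_pushes ⟨hu0, hu1.le⟩ ⟨hv0, hv1.le⟩
    ((shellHomeo (ε j) j).injective hst)
  exact Subtype.ext (by rw [hs, ht, this])

/-- Continuity on consecutive closed intervals gives continuity on their union. -/
theorem continuousOn_preimage_Icc {X Y : Type*} [TopologicalSpace X] [TopologicalSpace Y]
    {f : X → Y} {p : X → ℝ} (hp : Continuous p) {a : ℕ → ℝ} (ha : Monotone a)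
    (hf : ∀ i, ContinuousOn f (p ⁻¹' Icc (a i) (a (i + 1)))) (n : ℕ) :
    ContinuousOn f (p ⁻¹' Icc (a 0) (a (n + 1))) := by
  induction n with
  | zero => exact hf 0
  | succ n ih =>
    rw [← Icc_union_Icc_eq_Icc (ha (Nat.zero_le (n + 1))) (ha (Nat.le_succ (n + 1))),
      preimage_union]
    exact ih.union_of_isClosed (hf _) (isClosed_Icc.preimage hp) (isClosed_Icc.preimage hp)

theorem continuousOn_strandVec : ContinuousOn strandVec (Icc 0 1) := by
  have h := continuousOn_preimage_Icc (f := strandVec) (p := id) continuous_id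
    (a := fun i => (i : ℝ) / 7) (fun i j h => by
      have : (i : ℝ) ≤ j := by exact_mod_cast h
      show (i : ℝ) / 7 ≤ j / 7
      linarith) (fun i => ?_) 6
  · convert h using 1
    norm_num
  · have hc : Continuous fun u : ℝ => (AffineMap.lineMap (trefoilVertex 1 i)
        (trefoilVertex 1 (i + 1)) (7 * u - i) : E3).ofLp := by
      refine (PiLp.continuous_ofLp 2 _).comp (AffineMap.lineMap_continuous.comp ?_)
      fun_prop
    refine hc.continuousOn.congr fun u hu => ?_
    simp only [preimage_id, mem_Icc, Nat.cast_add, Nat.cast_one] at hu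
    have : u = ((i : ℝ) + (7 * u - i)) / 7 := by ring
    conv_lhs => rw [this]
    rw [strandVec, trefoilStrand_div_seven 1 (by linarith) (by linarith)]

theorem continuous_trefoilSum (ε : ℕ → ℤˣ) : Continuous (trefoilSum ε) := by
  rw [continuous_iff_continuousAt]
  intro t
  by_cases ht : t = 1
  · subst ht
    rw [ContinuousAt, trefoilSum_one]
    suffices h : Tendsto (fun t => (trefoilSum ε t).ofLp) (𝓝 1) (𝓝 0) by
      exact ((PiLp.continuous_toLp 2 _).tendsto _).comp h
    have hb : ∀ t : unitInterval, ‖(trefoilSum ε t).ofLp‖ ≤ 32 * (1 - t) := by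
      intro t
      have ht0 : 0 ≤ 1 - (t : ℝ) := by linarith [t.2.2]
      by_cases ht : t = 1
      · subst ht; simp [trefoilSum_one]
      obtain ⟨k, u, h0, h1, htu⟩ := exists_eq_one_sub ht
      have h2 : (0 : ℝ) < (1 / 2) ^ k := by positivity
      rw [trefoilSum_eq ε k ⟨h0, h1.le⟩ htu]
      refine (pi_norm_le_iff_of_nonneg (by positivity)).2 fun i => ?_
      obtain ⟨⟨hl, hr⟩, hn, -⟩ := strandVec_bounds ⟨h0, h1.le⟩
      have hi := (norm_le_pi_norm (strandVec u) i)
      rw [Real.norm_eq_abs, abs_shellHomeo_apply, htu]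
      rw [Real.norm_eq_abs, hn] at hi
      nlinarith
    refine squeeze_zero_norm hb ?_
    have : Continuous fun t : unitInterval => 32 * (1 - (t : ℝ)) := by fun_prop
    simpa using this.tendsto 1
  · have ht1 : 0 < 1 - (t : ℝ) := sub_pos.2 (lt_of_le_of_ne t.2.2 fun h => ht (Subtype.ext h))
    have h := continuousOn_preimage_Icc (f := trefoilSum ε) continuous_subtype_val
      (a := fun k => 1 - (1 / 2 : ℝ) ^ k)
      (fun i j h => sub_le_sub_left (pow_le_pow_of_le_one (by norm_num) (by norm_num) h) 1)
      (fun k => ?_)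
    · obtain ⟨n, hn⟩ := exists_pow_lt_of_lt_one ht1 (by norm_num : (1 / 2 : ℝ) < 1)
      have h2 : (1 / 2 : ℝ) ^ (n + 1) ≤ (1 / 2) ^ n :=
        pow_le_pow_of_le_one (by norm_num) (by norm_num) n.le_succ
      refine (h n).continuousAt (mem_of_superset (continuous_subtype_val.continuousAt
        (Iio_mem_nhds (show (t : ℝ) < 1 - (1 / 2) ^ (n + 1) by linarith))) ?_)
      intro s hs
      exact ⟨by simpa using s.2.1, (mem_Iio.1 hs).le⟩
    · have h2 : (0 : ℝ) < (1 / 2) ^ k := by positivity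
      have h22 : (1 / 2) ^ k * (2 : ℝ) ^ k = 1 := by rw [← mul_pow]; norm_num
      have h2p : (0 : ℝ) < 2 ^ k := by positivity
      have hmaps : ∀ t : unitInterval, t ∈ Subtype.val ⁻¹'
          Icc (1 - (1 / 2 : ℝ) ^ k) (1 - (1 / 2) ^ (k + 1)) →
          2 - 2 ^ (k + 1) * (1 - (t : ℝ)) ∈ Icc (0 : ℝ) 1 := by
        rintro t ⟨hl, hr⟩
        rw [pow_succ] at hr ⊢
        constructor <;> nlinarith
      refine ((shellHomeo (ε k) k).continuous.comp_continuousOn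
        (continuousOn_strandVec.comp (by fun_prop) hmaps)).congr fun t ht =>
          trefoilSum_eq ε k (hmaps t ht) ?_
      rw [pow_succ]
      linear_combination (1 - (t : ℝ)) * h22

theorem isEmbedding_trefoilSum (ε : ℕ → ℤˣ) : IsEmbedding (trefoilSum ε) :=
  ((continuous_trefoilSum ε).isClosedEmbedding (injective_trefoilSum ε)).isEmbedding

/-- The `k`-th trefoil can be pulled straight inside its shell. -/
theorem exists_isotopy_shell (ε : ℤˣ) (k : ℕ) :
    ∃ H : unitInterval → E3 → E3, IsIsotopy H ∧ (∀ s, ∀ y ∉ shell k, H s y = y) ∧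
      H 1 '' (shellHomeo ε k '' (strandVec '' Icc 0 1)) =
        segment ℝ (axisPoint (-16 * (1 / 2) ^ k)) (axisPoint (-16 * (1 / 2) ^ (k + 1))) := by
  obtain ⟨H, hH, hfix, himg⟩ := exists_isotopy_straighten
  refine ⟨_, hH.conj (shellHomeo ε k), fun s y hy => ?_, ?_⟩
  · obtain ⟨z, rfl⟩ := (shellHomeo ε k).surjective y
    rw [shellHomeo_mem_shell_iff, not_and_or, not_le, not_lt] at hy
    rw [Homeomorph.symm_apply_apply, hfix s z (hy.symm.imp_right le_of_lt)]
  · have h2 : (0 : ℝ) < (1 / 2) ^ k := by positivity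
    have : (fun z => shellHomeo ε k (H 1 ((shellHomeo ε k).symm z))) ''
        (shellHomeo ε k '' (strandVec '' Icc 0 1)) =
        shellHomeo ε k '' (H 1 '' (strandVec '' Icc 0 1)) := by
      simp only [image_image, Homeomorph.symm_apply_apply]
    rw [this, himg, image_image]
    simp only [shellHomeo_axisVec]
    rw [← axisPoint_image_Icc (by rw [pow_succ]; linarith), ← image_image axisPoint,
      image_mul_left_Icc h2.le (by norm_num)]
    congr 2
    · ring
    · rw [pow_succ]; ring

/-! ### The shells -/

theorem box_antitone : Antitone box := fun m n h p hp i =>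
  (hp i).trans (mul_le_mul_of_nonneg_left
    (pow_le_pow_of_le_one (by norm_num) (by norm_num) h) (by norm_num))

theorem shell_subset_box {k n : ℕ} (h : n ≤ k) : shell k ⊆ box n :=
  sdiff_subset.trans (box_antitone h)

theorem disjoint_shell_box {k n : ℕ} (h : k < n) : Disjoint (shell k) (box n) :=
  disjoint_left.2 fun _ hy hn => hy.2 (box_antitone h hn)

theorem pairwise_disjoint_shell : Pairwise fun j k => Disjoint (shell j) (shell k) := by
  intro j k h
  rcases h.lt_or_gt with h | h
  · exact (disjoint_shell_box h).mono_right sdiff_subset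
  · exact ((disjoint_shell_box h).mono_right sdiff_subset).symm

theorem eq_of_mem_shell {j k : ℕ} {y : E3} (hj : y ∈ shell j) (hk : y ∈ shell k) : j = k := by
  by_contra h
  exact disjoint_left.1 (pairwise_disjoint_shell h) hj hk

theorem zero_mem_box (n : ℕ) : (0 : E3) ∈ box n := fun i => by
  rw [PiLp.zero_apply, abs_zero]
  positivity

theorem norm_le_of_mem_box {n : ℕ} {y : E3} (hy : y ∈ box n) : ‖y‖ ≤ 28 * (1 / 2) ^ n := by
  refine le_of_sq_le_sq ?_ (by positivity)
  rw [EuclideanSpace.norm_sq_eq, Fin.sum_univ_three]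
  have h : ∀ i, ‖y i‖ ^ 2 ≤ (16 * (1 / 2) ^ n) ^ 2 := fun i =>
    pow_le_pow_left₀ (norm_nonneg _) (hy i) 2
  nlinarith [h 0, h 1, h 2, sq_nonneg ((1 / 2 : ℝ) ^ n)]

theorem box_mem_nhds_zero (n : ℕ) : box n ∈ 𝓝 (0 : E3) := by
  refine mem_of_superset (Metric.ball_mem_nhds 0 (show (0 : ℝ) < 16 * (1 / 2) ^ n by positivity))
    fun y hy i => ?_
  exact (PiLp.norm_apply_le y i).trans (mem_ball_zero_iff.1 hy).le

theorem exists_box_subset_ball {r : ℝ} (hr : 0 < r) : ∃ n, box n ⊆ Metric.ball 0 r := by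
  obtain ⟨n, hn⟩ := exists_pow_lt_of_lt_one (show 0 < r / 28 by positivity)
    (by norm_num : (1 / 2 : ℝ) < 1)
  refine ⟨n, fun y hy => mem_ball_zero_iff.2 ((norm_le_of_mem_box hy).trans_lt ?_)⟩
  linarith

theorem isClosed_box (n : ℕ) : IsClosed (box n) := by
  have : box n = ⋂ i, {p : E3 | |p i| ≤ 16 * (1 / 2 : ℝ) ^ n} := by ext; simp [box]
  rw [this]
  exact isClosed_iInter fun i => isClosed_le (by fun_prop) continuous_const

/-! ### Performing infinitely many isotopies, one in each shell -/

section Shellwise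

variable {H : ℕ → unitInterval → E3 → E3}

/-- The `k`-th map is an isotopy that moves only points of the `k`-th shell. -/
structure IsShellFamily (H : ℕ → unitInterval → E3 → E3) : Prop where
  isotopy : ∀ k, IsIsotopy (H k)
  apply_of_notMem : ∀ k s, ∀ y ∉ shell k, H k s y = y

open scoped Classical in
/-- The map which, on the `k`-th shell, is the isotopy `H k` at time `s k`, and which is the identity
off the shells. -/
def shellwise (H : ℕ → unitInterval → E3 → E3) (s : ℕ → unitInterval) (y : E3) : E3 :=
  if h : ∃ k, y ∈ shell k then H h.choose (s h.choose) y else y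

theorem shellwise_of_mem {s : ℕ → unitInterval} {k : ℕ} {y : E3} (hy : y ∈ shell k) :
    shellwise H s y = H k (s k) y := by
  have h : ∃ k, y ∈ shell k := ⟨k, hy⟩
  rw [shellwise, dif_pos h, eq_of_mem_shell h.choose_spec hy]

theorem shellwise_of_forall_notMem {s : ℕ → unitInterval} {y : E3} (hy : ∀ k, y ∉ shell k) :
    shellwise H s y = y := dif_neg (not_exists.2 hy)

theorem shellwise_zero_point (s : ℕ → unitInterval) : shellwise H s 0 = 0 :=
  shellwise_of_forall_notMem fun _ h => h.2 (zero_mem_box _)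

namespace IsShellFamily

theorem apply_mem_shell_iff (hH : IsShellFamily H) {k : ℕ} {s : unitInterval} {y : E3} :
    H k s y ∈ shell k ↔ y ∈ shell k := by
  by_cases hy : y ∈ shell k
  · refine iff_of_true (by_contra fun h => h ?_) hy
    rwa [((hH.isotopy k).homeomorph s).injective (hH.apply_of_notMem k s _ h)]
  · rw [hH.apply_of_notMem k s y hy]

theorem shellwise_mem_shell_iff (hH : IsShellFamily H) {s : ℕ → unitInterval} {k : ℕ} {y : E3} :
    shellwise H s y ∈ shell k ↔ y ∈ shell k := by
  by_cases h : ∃ j, y ∈ shell j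
  · obtain ⟨j, hj⟩ := h
    have hj' : shellwise H s y ∈ shell j := by
      rwa [shellwise_of_mem hj, hH.apply_mem_shell_iff]
    exact ⟨fun hk => eq_of_mem_shell hj' hk ▸ hj, fun hk => eq_of_mem_shell hj hk ▸ hj'⟩
  · rw [shellwise_of_forall_notMem (not_exists.1 h)]

theorem shellwise_mem_box (hH : IsShellFamily H) {s : ℕ → unitInterval} {n : ℕ} {y : E3}
    (hy : y ∈ box n) : shellwise H s y ∈ box n := by
  by_cases h : ∃ k, y ∈ shell k
  · obtain ⟨k, hk⟩ := h
    refine shell_subset_box ?_ (hH.shellwise_mem_shell_iff.2 hk)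
    by_contra hn
    exact disjoint_left.1 (disjoint_shell_box (not_le.1 hn)) hk hy
  · rwa [shellwise_of_forall_notMem (not_exists.1 h)]

theorem shellwise_eq_self (hH : IsShellFamily H) {s : ℕ → unitInterval} {y : E3}
    (hs : ∀ k, y ∈ shell k → s k = 0) : shellwise H s y = y := by
  by_cases h : ∃ k, y ∈ shell k
  · obtain ⟨k, hk⟩ := h
    rw [shellwise_of_mem hk, hs k hk, (hH.isotopy k).zero]
  · exact shellwise_of_forall_notMem (not_exists.1 h)

/-- An isotopy in a shell that has been at rest may be performed at once or afterwards. -/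
theorem apply_shellwise (hH : IsShellFamily H) {s : ℕ → unitInterval} {n : ℕ} (hs : s n = 0)
    (a : unitInterval) (y : E3) :
    H n a (shellwise H s y) = shellwise H (Function.update s n a) y := by
  by_cases hn : y ∈ shell n
  · rw [shellwise_of_mem hn, shellwise_of_mem hn, hs, (hH.isotopy n).zero, Function.update_self]
  · rw [hH.apply_of_notMem n a _ (hH.shellwise_mem_shell_iff.not.2 hn)]
    by_cases h : ∃ k, y ∈ shell k
    · obtain ⟨k, hk⟩ := h
      rw [shellwise_of_mem hk, shellwise_of_mem hk,
        Function.update_of_ne (by rintro rfl; exact hn hk)]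
    · rw [shellwise_of_forall_notMem (not_exists.1 h), shellwise_of_forall_notMem (not_exists.1 h)]

theorem shellwise_bijective (hH : IsShellFamily H) (s : ℕ → unitInterval) :
    Function.Bijective (shellwise H s) := by
  refine ⟨fun y z h => ?_, fun z => ?_⟩
  · by_cases hy : ∃ k, y ∈ shell k
    · obtain ⟨k, hk⟩ := hy
      have hz : z ∈ shell k := by
        rw [← hH.shellwise_mem_shell_iff (s := s), ← h]
        exact hH.shellwise_mem_shell_iff.2 hk
      rw [shellwise_of_mem hk, shellwise_of_mem hz] at h
      exact ((hH.isotopy k).homeomorph _).injective h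
    · have hz : ¬∃ k, z ∈ shell k := by
        rintro ⟨k, hk⟩
        rw [← hH.shellwise_mem_shell_iff (s := s), ← h, hH.shellwise_mem_shell_iff] at hk
        exact hy ⟨k, hk⟩
      rwa [shellwise_of_forall_notMem (not_exists.1 hy),
        shellwise_of_forall_notMem (not_exists.1 hz)] at h
  · by_cases hz : ∃ k, z ∈ shell k
    · obtain ⟨k, hk⟩ := hz
      obtain ⟨y, rfl⟩ := ((hH.isotopy k).homeomorph (s k)).surjective z
      exact ⟨y, shellwise_of_mem (hH.apply_mem_shell_iff.1 hk)⟩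
    · exact ⟨z, shellwise_of_forall_notMem (not_exists.1 hz)⟩

/-- Away from the origin only finitely many isotopies matter, and near the origin the map preserves
the arbitrarily small boxes. -/
theorem continuous_shellwise (hH : IsShellFamily H) {T : Type*} [TopologicalSpace T]
    {σ : T → ℕ → unitInterval} (hσ : ∀ k, Continuous fun τ => σ τ k) :
    Continuous fun p : T × E3 => shellwise H (σ p.1) p.2 := by
  rw [continuous_iff_continuousAt]
  rintro ⟨τ, y⟩
  by_cases hy : y = 0
  · subst hy
    rw [ContinuousAt, shellwise_zero_point, Metric.tendsto_nhds]
    intro r hr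
    obtain ⟨n, hn⟩ := exists_box_subset_ball hr
    filter_upwards [continuous_snd.continuousAt.eventually (box_mem_nhds_zero n)] with p hp
    exact hn (hH.shellwise_mem_box hp)
  · have hfin : ∀ n, Continuous fun p : T × E3 =>
        shellwise H (fun k => if k < n then σ p.1 k else 0) p.2 := by
      intro n
      induction n with
      | zero =>
        simp only [not_lt_zero, if_false]
        exact continuous_snd.congr fun p => (hH.shellwise_eq_self fun _ _ => rfl).symm
      | succ n ih =>
        refine ((hH.isotopy n).continuous_apply ((hσ n).comp continuous_fst) ih).congr fun p => ?_
        rw [Function.comp_apply, hH.apply_shellwise (if_neg (lt_irrefl n))]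
        congr 1
        ext1 k
        rcases lt_trichotomy k n with h | rfl | h
        · rw [Function.update_of_ne h.ne, if_pos h, if_pos (by omega)]
        · rw [Function.update_self, if_pos (by omega)]
        · rw [Function.update_of_ne h.ne', if_neg (by omega), if_neg (by omega)]
    obtain ⟨n, hn⟩ := exists_box_subset_ball (norm_pos_iff.2 hy)
    have hyn : y ∉ box n := fun h => by simpa using hn h
    refine (hfin n).continuousAt.congr ?_
    filter_upwards [continuous_snd.continuousAt.eventually
      ((isClosed_box n).isOpen_compl.mem_nhds hyn)] with p hp
    by_cases h : ∃ k, p.2 ∈ shell k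
    · obtain ⟨k, hk⟩ := h
      rw [shellwise_of_mem hk, shellwise_of_mem hk, if_pos]
      by_contra hkn
      exact hp (shell_subset_box (not_lt.1 hkn) hk)
    · rw [shellwise_of_forall_notMem (not_exists.1 h), shellwise_of_forall_notMem (not_exists.1 h)]

theorem isHomeomorph_shellwise (hH : IsShellFamily H) (s : ℕ → unitInterval) :
    IsHomeomorph (shellwise H s) := by
  refine isHomeomorph_of_eq_id_of_le_norm (R := 29) ?_ (hH.shellwise_bijective s) fun y hy => ?_
  · exact (hH.continuous_shellwise (σ := fun _ : Unit => s) fun _ => continuous_const).comp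
      (continuous_const (y := ()) |>.prodMk continuous_id)
  · refine shellwise_of_forall_notMem fun k hk => ?_
    have := norm_le_of_mem_box (shell_subset_box (Nat.zero_le k) hk)
    rw [pow_zero] at this
    linarith

theorem isIsotopy_shellwise (hH : IsShellFamily H) {σ : unitInterval → ℕ → unitInterval}
    (hσ : ∀ k, Continuous fun τ => σ τ k) (h0 : ∀ k, σ 0 k = 0) :
    IsIsotopy fun τ => shellwise H (σ τ) where
  continuous := hH.continuous_shellwise hσ
  zero _ := hH.shellwise_eq_self fun k _ => h0 k
  homeomorph τ := hH.isHomeomorph_shellwise (σ τ)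

theorem endComp_eq_shellwise (hH : IsShellFamily H) (n : ℕ) (y : E3) :
    endComp H n y = shellwise H (fun k => if k < n then 1 else 0) y := by
  induction n with
  | zero => exact (hH.shellwise_eq_self fun _ _ => rfl).symm
  | succ n ih =>
    rw [endComp, Function.comp_apply, ih, hH.apply_shellwise (if_neg (lt_irrefl n))]
    congr 1
    ext1 k
    rcases lt_trichotomy k n with h | rfl | h
    · rw [Function.update_of_ne h.ne, if_pos h, if_pos (by omega)]
    · rw [Function.update_self, if_pos (by omega)]
    · rw [Function.update_of_ne h.ne', if_neg (by omega), if_neg (by omega)]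

end IsShellFamily

/-- The time which the `k`-th isotopy has reached at time `τ`, if it is performed during
`[t k, t (k + 1)]`. -/
def localTime (t : ℕ → unitInterval) (τ : unitInterval) (k : ℕ) : unitInterval :=
  projIcc 0 1 zero_le_one (((τ : ℝ) - t k) / (t (k + 1) - t k))

section localTime

variable {t : ℕ → unitInterval} {τ : unitInterval} {k : ℕ}

theorem continuous_localTime (t : ℕ → unitInterval) (k : ℕ) :
    Continuous fun τ => localTime t τ k := by
  refine continuous_projIcc.comp ?_
  fun_prop

theorem localTime_eq_zero (ht : StrictMono t) (h : τ ≤ t k) : localTime t τ k = 0 := by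
  have h' : (τ : ℝ) ≤ t k := h
  have hk : (t k : ℝ) < t (k + 1) := ht k.lt_succ_self
  exact projIcc_of_le_left _ (div_nonpos_of_nonpos_of_nonneg (by linarith) (by linarith))

theorem localTime_eq_one (ht : StrictMono t) (h : t (k + 1) ≤ τ) : localTime t τ k = 1 := by
  have h' : (t (k + 1) : ℝ) ≤ τ := h
  have hk : (t k : ℝ) < t (k + 1) := ht k.lt_succ_self
  exact projIcc_of_right_le _ ((one_le_div (by linarith)).2 (by linarith))

theorem localTime_eq (ht : StrictMono t) {s : unitInterval}
    (h : (τ : ℝ) = t k + s * (t (k + 1) - t k)) : localTime t τ k = s := by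
  have hk : (0 : ℝ) < t (k + 1) - t k := sub_pos.2 (ht k.lt_succ_self)
  rw [localTime, h, add_sub_cancel_left, mul_div_cancel_right₀ _ hk.ne', projIcc_val]

end localTime

theorem IsShellFamily.isIteratedGluing (hH : IsShellFamily H) {t : ℕ → unitInterval}
    (ht : StrictMono t) : IsIteratedGluing t H fun τ => shellwise H (localTime t τ) := by
  refine ⟨fun k s τ hτ y => ?_, fun y => ?_⟩
  · rw [hH.endComp_eq_shellwise, hH.apply_shellwise (if_neg (lt_irrefl k))]
    have hk : (0 : ℝ) < t (k + 1) - t k := sub_pos.2 (ht k.lt_succ_self)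
    have hl : t k ≤ τ := by
      show (t k : ℝ) ≤ τ
      nlinarith [s.2.1]
    have hr : τ ≤ t (k + 1) := by
      show (τ : ℝ) ≤ t (k + 1)
      nlinarith [s.2.2]
    show shellwise H (localTime t τ) y = _
    congr 1
    ext1 j
    rcases lt_trichotomy j k with h | rfl | h
    · rw [Function.update_of_ne h.ne, if_pos h,
        localTime_eq_one ht ((ht.monotone (Nat.succ_le_of_lt h)).trans hl)]
    · rw [Function.update_self, localTime_eq ht hτ]
    · rw [Function.update_of_ne h.ne', if_neg (by omega),
        localTime_eq_zero ht (hr.trans (ht.monotone (Nat.succ_le_of_lt h)))]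
  · refine tendsto_const_nhds.congr' ?_
    by_cases h : ∃ k, y ∈ shell k
    · obtain ⟨k, hk⟩ := h
      filter_upwards [eventually_gt_atTop k] with n hn
      rw [hH.endComp_eq_shellwise, shellwise_of_mem hk, shellwise_of_mem hk, if_pos hn,
        localTime_eq_one ht unitInterval.le_one']
    · refine Eventually.of_forall fun n => ?_
      simp only [hH.endComp_eq_shellwise, shellwise_of_forall_notMem (not_exists.1 h)]

end Shellwise

/-! ### The infinite sum of trefoils is tame -/

/-- If every trefoil is pulled straight in its shell, the image of the whole arc is a segment. -/
theorem range_shellwise_comp_trefoilSum {ε : ℕ → ℤˣ} {H : ℕ → unitInterval → E3 → E3}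
    (hH : IsShellFamily H)
    (himg : ∀ k, H k 1 '' trefoilPiece ε k =
      segment ℝ (axisPoint (-16 * (1 / 2) ^ k)) (axisPoint (-16 * (1 / 2) ^ (k + 1)))) :
    range (shellwise H (fun _ => 1) ∘ trefoilSum ε) = segment ℝ (axisPoint (-16)) 0 := by
  have hz : (0 : E3) = axisPoint 0 := by ext i; fin_cases i <;> simp [axisPoint]
  have hseg : ∀ k : ℕ, H k 1 '' trefoilPiece ε k =
      axisPoint '' Icc (-16 * (1 / 2) ^ k) (-16 * (1 / 2) ^ (k + 1)) := fun k => by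
    have h2 : (0 : ℝ) < (1 / 2) ^ k := by positivity
    rw [himg, axisPoint_image_Icc (by rw [pow_succ]; linarith)]
  have hshell : ∀ (k : ℕ) (u : ℝ), 0 ≤ u → u < 1 →
      shellHomeo (ε k) k (strandVec u) ∈ shell k := by
    intro k u h0 h1
    obtain ⟨⟨hl, hr⟩, hn, hone, -⟩ := strandVec_bounds ⟨h0, h1.le⟩
    rw [shellHomeo_mem_shell_iff, hn]
    have := lt_of_le_of_ne hr fun h => h1.ne (hone h)
    constructor <;> linarith
  rw [hz, ← axisPoint_image_Icc (by norm_num)]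
  refine Subset.antisymm ?_ ?_
  · rintro _ ⟨t, rfl⟩
    rw [Function.comp_apply]
    by_cases ht : t = 1
    · rw [ht, trefoilSum_one, shellwise_zero_point, hz]
      exact ⟨0, ⟨by norm_num, le_rfl⟩, rfl⟩
    obtain ⟨k, u, h0, h1, htu⟩ := exists_eq_one_sub ht
    have hmem : H k 1 (shellHomeo (ε k) k (strandVec u)) ∈ H k 1 '' trefoilPiece ε k := by
      rw [trefoilPiece_eq]
      exact mem_image_of_mem _ (mem_image_of_mem _ (mem_image_of_mem _ ⟨h0, h1.le⟩))
    rw [trefoilSum_eq ε k ⟨h0, h1.le⟩ htu, shellwise_of_mem (hshell k u h0 h1)]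
    rw [hseg] at hmem
    refine image_mono (Icc_subset_Icc ?_ ?_) hmem
    · have : (1 / 2 : ℝ) ^ k ≤ 1 := pow_le_one₀ (by norm_num) (by norm_num)
      linarith
    · have : (0 : ℝ) < (1 / 2) ^ (k + 1) := by positivity
      linarith
  · rintro _ ⟨x, ⟨hx16, hx0⟩, rfl⟩
    rcases hx0.eq_or_lt with rfl | hx0
    · exact ⟨1, by rw [Function.comp_apply, trefoilSum_one, shellwise_zero_point, hz]⟩
    obtain ⟨k, h1, h2⟩ := exists_nat_pow_near (x := 16 / -x) (y := 2)
      ((one_le_div (by linarith)).2 (by linarith)) one_lt_two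
    rw [le_div_iff₀ (by linarith)] at h1
    rw [div_lt_iff₀ (by linarith)] at h2
    have hp : (0 : ℝ) < (1 / 2) ^ k := by positivity
    have h22 : (1 / 2) ^ k * (2 : ℝ) ^ k = 1 := by rw [← mul_pow]; norm_num
    have hl : -16 * (1 / 2) ^ k ≤ x := by
      have := mul_le_mul_of_nonneg_left h1 hp.le
      linear_combination this + x * h22
    have hr : x < -16 * (1 / 2) ^ (k + 1) := by
      have := mul_lt_mul_of_pos_left h2 hp
      rw [pow_succ] at this ⊢
      linear_combination 1 / 2 * this - x * h22
    have hmem : axisPoint x ∈ H k 1 '' trefoilPiece ε k := by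
      rw [hseg]
      exact ⟨x, ⟨hl, hr.le⟩, rfl⟩
    rw [trefoilPiece_eq] at hmem
    obtain ⟨_, ⟨_, ⟨u, hu, rfl⟩, rfl⟩, hHu⟩ := hmem
    rcases hu.2.eq_or_lt with rfl | hu1
    · -- the end of the trefoil is not in the shell, hence fixed by the isotopy
      exfalso
      have hv : strandVec 1 = axisVec (-8) := by
        have := trefoilStrand_div_seven 1 (i := 6) (τ := 1) zero_le_one le_rfl
        norm_num at this
        rw [strandVec, this]
        ext j
        fin_cases j <;> simp [trefoilVertex, axisVec]
      rw [hv, hH.apply_of_notMem, shellHomeo_axisVec] at hHu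
      · have := congrArg (fun p : E3 => p 0) hHu
        simp only [axisPoint, Matrix.cons_val] at this
        rw [pow_succ] at hr
        linarith
      · rw [shellHomeo_mem_shell_iff, norm_axisVec]
        norm_num
    · have ht : 1 - (1 / 2 : ℝ) ^ k * (1 - u / 2) ∈ Icc (0 : ℝ) 1 := by
        have : (1 / 2 : ℝ) ^ k ≤ 1 := pow_le_one₀ (by norm_num) (by norm_num)
        constructor <;> nlinarith [hu.1]
      exact ⟨⟨_, ht⟩, by rw [Function.comp_apply, trefoilSum_eq ε k hu rfl,
        shellwise_of_mem (hshell k u hu.1 hu1), hHu]⟩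

end

/-- The countable connected sum of shrinking trefoils is a tame arc. Moreover there are isotopies
`H k` of `ℝ³`, each fixing every point off the shell `V k \ V (k + 1)` and pulling the `k`-th trefoil
straight, such that performing them successively in time gives an ambient isotopy from the arc to
an arc whose image is a straight segment. -/
theorem proposition4p5 (ε : ℕ → ℤˣ) :
    IsTameArc (trefoilSum ε) ∧
    Pairwise (fun j k => Disjoint (shell j) (shell k)) ∧
    ∃ (H : ℕ → unitInterval → E3 → E3) (g : unitInterval → E3),
      (∀ k, IsIsotopy (H k) ∧
        (∀ s, ∀ y ∉ shell k, H k s y = y) ∧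
        H k 1 '' trefoilPiece ε k =
          segment ℝ (axisPoint (-16 * (1 / 2) ^ k)) (axisPoint (-16 * (1 / 2) ^ (k + 1)))) ∧
      range g = segment ℝ (axisPoint (-16)) 0 ∧
      ∀ t : ℕ → unitInterval, StrictMono t → t 0 = 0 → Tendsto t atTop (𝓝 1) →
        ∃ Hinf : unitInterval → E3 → E3,
          IsIteratedGluing t H Hinf ∧ IsAmbientIsotopy Hinf (trefoilSum ε) g := by
  choose H hiso hfix himg using fun k => exists_isotopy_shell (ε k) k
  simp only [← trefoilPiece_eq] at himg
  have hH : IsShellFamily H := ⟨hiso, hfix⟩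
  have hrange := range_shellwise_comp_trefoilSum hH himg
  have hf := isEmbedding_trefoilSum ε
  have hg : IsEmbedding (shellwise H (fun _ => 1) ∘ trefoilSum ε) :=
    (hH.isHomeomorph_shellwise _).isEmbedding.comp hf
  refine ⟨⟨hf, _, ⟨hg, {(axisPoint (-16), 0)}, by simp [hrange]⟩,
    fun τ => shellwise H fun _ => τ, hf, hg,
    hH.isIsotopy_shellwise (fun _ => continuous_id) fun _ => rfl, fun _ => rfl⟩,
    pairwise_disjoint_shell, H, _, fun k => ⟨hiso k, hfix k, himg k⟩, hrange,
    fun t ht _ _ => ⟨_, hH.isIteratedGluing ht, hf, hg, hH.isIsotopy_shellwise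
      (continuous_localTime t) fun k => localTime_eq_zero ht unitInterval.nonneg', fun x => ?_⟩⟩
  have : localTime t 1 = fun _ => 1 := funext fun k => localTime_eq_one ht unitInterval.le_one'
  rw [this, Function.comp_apply]
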